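/- **Setting.** Let $T$ be the finite set of nodes of a rooted tree with root $\square$. For $s\in T$ let $C(s)$ be its set of children, $m(s)$ the set consisting of its mother ($m(\square)=\emptyset$), and, for $S\subseteq T$, let $\downarrow\! S$ be the set of the nodes in $S$ and all their descendants. Each $s\in T$ carries a variable $X_s$ with values in a non-empty finite set $\mathcal X_s$; put $\mathcal X_S=\prod_{s\in S}\mathcal X_s$, and let $\mathcal L(S)$ be the set of gambles, i.e. real functions, on $\mathcal X_S$ (identified with their cylindrical extensions). For disjoint $I,O\subseteq T$, a conditional lower prevision $\underline V_O(\cdot|X_I)$ assigns to each $f\in\mathcal L(I\cup O)$ and $x_I\in\mathcal X_I$ a real number $\underline V_O(f|x_I)=\underline V_O(f(x_I,\cdot)|x_I)$ (unconditional if $I=\emptyset$). It is separately coherent if each functional $\underline V_O(\cdot|x_I)$ on $\mathcal L(O)$ is super-additive, non-negatively homogeneous, and satisfies $\underline V_O(f|x_I)\ge\min f$. Its conjugate is $\overline V_O(f|x_I)=-\underline V_O(-f|x_I)$; a functional $\Phi$ is strictly positive if $\Phi(\mathbb I_{\{x\}})>0$ for every point $x$. Separately coherent $\underline V_{O_j}(\cdot|X_{I_j})$,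 $j=1,\dots,n$, are *jointly coherent* if for all $f_j\in\mathcal L(I_j\cup O_j)$, all $j_0$, $f_0\in\mathcal L(I_{j_0}\cup O_{j_0})$ and $z_0\in\mathcal X_{I_{j_0}}$ there is an event $B\subseteq\mathcal X_T$, equal to $\{x_{I_{j_0}}=z_0\}$ or to $\{x_{I_j}=z\}$ for some $j$ and $z$ with $f_j(z,\cdot)\neq0$, such that $$\max_{x\in B}\Big(\sum_{j}\big[f_j-\underline V_{O_j}(f_j|X_{I_j})\big]-\mathbb I_{\{x_{I_{j_0}}=z_0\}}\big[f_0-\underline V_{O_{j_0}}(f_0|z_0)\big]\Big)(x)\ \ge\ 0.$$ Let a separately coherent local model $\underline Q_s(\cdot|X_{m(s)})$ on $\mathcal L(\{s\})$ be given for each $s\in T$. For $s$ with $C(s)\ne\emptyset$ and separately coherent models $\underline P_{\downarrow c}(\cdot|X_s)$, $c\in C(s)$, a model $\underline R(\cdot|X_s)$ on $\mathcal L(\downarrow\! C(s))$ is a *conditionally independent product* of them if it extends each of them and is jointly coherent with all the models $\underline R_{\downarrow O}(h|z_s,z_{\downarrow I}):=\underline R(h(\cdot,z_{\downarrow I})|z_s)$,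 where $O\neq\emptyset$ and $I$ are disjoint proper subsets of $C(s)$. The point-wise smallest one, if it exists, is the *conditionally independent natural extension* $\otimes_{c\in C(s)}\underline P_{\downarrow c}(\cdot|X_s)$. The *global models* are defined by recursion from the leaves to the root: $\underline P_{\downarrow t}(\cdot|X_{m(t)})=\underline Q_t(\cdot|X_{m(t)})$ for leaves $t$, and, for $C(s)\neq\emptyset$, $$\underline P_{\downarrow C(s)}(\cdot|X_s)=\otimes_{c\in C(s)}\underline P_{\downarrow c}(\cdot|X_s),\qquad \underline P_{\downarrow s}(\cdot|X_{m(s)})=\underline Q_s\big(\underline P_{\downarrow C(s)}(\cdot|X_s)\big|X_{m(s)}\big).$$ The family of global models $\mathcal T(\underline P)$ consists of the joint $\underline P=\underline P_{\downarrow\square}$ and the restrictions $\underline P_{\downarrow S}(\cdot|X_s)$ of $\underline P_{\downarrow C(s)}(\cdot|X_s)$ to $\mathcal L(\downarrow\! S)$, for all non-terminal $s$ and non-empty $S\subseteq C(s)$. Consider the following requirements on a family $\mathcal T(\underline V)$ of a joint $\underline V$ on $\mathcal L(T)$ and conditional models $\underline V_{\downarrow S}(\cdot|X_s)$ ($s$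 non-terminal, $\emptyset\ne S\subseteq C(s)$), where $\underline V_{\downarrow s}(\cdot|X_{m(s)})$ denotes $\underline V$ if $s=\square$ and $\underline V_{\downarrow\{s\}}(\cdot|X_{m(s)})$ otherwise: * T1: for each $s\in T$, $\underline Q_s(\cdot|X_{m(s)})$ is the restriction of $\underline V_{\downarrow s}(\cdot|X_{m(s)})$ to $\mathcal L(\{s\})$. * T2: the models in $\mathcal T(\underline V)$ are jointly coherent. * T3: the models in $\mathcal T(\underline V)$ are jointly coherent together with all the models $\underline V_{\downarrow S}(f|z_{\{s\}\cup R}):=\underline V_{\downarrow S}(f(\cdot,z_R)|z_s)$, $s$ non-terminal, $\emptyset\neq S\subseteq C(s)$, $R\subseteq\bigcap_{c\in S}T\setminus(m(c)\cup\downarrow\! c)$. * T4: the models in $\mathcal T(\underline V)$ are point-wise dominated by the corresponding models in every family that satisfies T1–T3. **Theorem.** Assume that all local upper previsions $\overline Q_s(\cdot|x_{m(s)})$, $s\in T$, $x_{m(s)}\in\mathcal X_{m(s)}$, are strictly positive. Then the conditionally independent natural extensions in the recursion exist, and the family $\mathcal T(\underline P)$ is the point-wise smallest family that satisfies T1, T2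 and T3. It is therefore the unique family that satisfies T1–T4. Finally, for every non-empty $E\subseteq T$, the maximum in the regular extension $$\underline R(f|x_E):=\max\{\mu\in\mathbb R:\underline P(\mathbb I_{\{x_E\}}[f-\mu])\ge0\},\qquad f\in\mathcal L(T),\ x_E\in\mathcal X_E,$$ is attained, and the conditional lower prevision $\underline R(\cdot|X_E)$ is jointly coherent with the models in $\mathcal T(\underline P)$. -/

import Mathlib

universe u v

namespace CredalTree

/-! ### Gambles and (conditional) lower previsions

The nodes of the tree are the elements of a finite `T : RootedTree`, ordered by precedence: the root
is `⊥`, and `t` is a child of `s` exactly when `s ⋖ t`. The variable of node `t` takes values in `X t`. -/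

/-- The set of joint values of the variables of the nodes in `A`. -/
abbrev Assign {T : Type u} (X : T → Type v) (A : Set T) : Type (max u v) := ∀ t : A, X t

/-- The gambles on `Y`. -/
abbrev Gamble (Y : Type*) : Type _ := Y → ℝ

/-- `P` is a (separately) coherent lower prevision on the gambles on `Y`
(for `Y` finite and non-empty, so that the infimum is a minimum). -/
structure IsCoherent {Y : Type*} (P : Gamble Y → ℝ) : Prop where
  min_le : ∀ f, ⨅ y, f y ≤ P f
  superadd : ∀ f g, P f + P g ≤ P (f + g)
  nonneg_hom : ∀ (c : ℝ) (f : Gamble Y), 0 ≤ c → P (c • f) = c * P f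

/-- The conjugate upper prevision. -/
def upper {Y : Type*} (P : Gamble Y → ℝ) : Gamble Y → ℝ := fun f => -P (-f)

/-- A real functional is strictly positive when it is positive on the indicator of each singleton. -/
def StrictlyPositive {Y : Type*} (P : Gamble Y → ℝ) : Prop :=
  ∀ y : Y, 0 < P (Set.indicator {y} 1)

/-- Conditional lower previsions about the variables in `O`, conditional on the variables in `I`,
for disjoint `O` and `I`: a functional on the gambles on `X_O` for each value of `X_I`.
A gamble `f` on `X_{I ∪ O}` is a map `Assign X I → Assign X O → ℝ`, and its lower prevision given
`x` is that of the partial map `f x`, as separate coherence demands. -/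
abbrev CondLP {T : Type u} (X : T → Type v) (O I : Set T) : Type (max u v) :=
  Assign X I → Gamble (Assign X O) → ℝ

/-- Separate coherence. -/
def SepCoherent {T : Type u} {X : T → Type v} {O I : Set T} (V : CondLP X O I) : Prop :=
  ∀ x, IsCoherent (V x)

/-- A conditional lower prevision bundled with its sets of variables. -/
structure CondModel {T : Type u} (X : T → Type v) where
  /-- the variables the model is about -/
  O : Set T
  /-- the conditioning variables -/
  I : Set T
  /-- the model itself -/
  low : CondLP X O I

/-- The gambles on `X_{I ∪ O}`. -/
abbrev CondModel.Dom {T : Type u} {X : T → Type v} (M : CondModel X) : Type (max u v) :=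
  Assign X M.I → Gamble (Assign X M.O)

/-- The conditioning event `X_I = z`, as a subset of the joint possibility space. -/
def cyl {T : Type u} {X : T → Type v} {I : Set T} (z : Assign X I) : Set (∀ t, X t) :=
  {ω | I.domRestrict ω = z}

/-- The gamble `G(f | X_I) = f - V(f | X_I)`. -/
def CondModel.gain {T : Type u} {X : T → Type v} (M : CondModel X) (f : M.Dom) :
    Gamble (∀ t, X t) :=
  fun ω => f (M.I.domRestrict ω) (M.O.domRestrict ω) - M.low (M.I.domRestrict ω) (f (M.I.domRestrict ω))

/-- The gamble `G(f | z) = 1_{X_I = z} (f - V(f | z))`. -/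
noncomputable def CondModel.gainAt {T : Type u} {X : T → Type v} (M : CondModel X) (f : M.Dom)
    (z : Assign X M.I) : Gamble (∀ t, X t) :=
  (cyl z).indicator (M.gain f)

/-- The `X_I`-support of `f`: the conditioning events on which `f` is not identically zero. -/
def CondModel.support {T : Type u} {X : T → Type v} (M : CondModel X) (f : M.Dom) :
    Set (Set (∀ t, X t)) :=
  {B | ∃ z, f z ≠ 0 ∧ B = cyl z}

/-- Walley's (joint) coherence of a finite collection of separately coherent conditional lower
previsions: for all gambles `f j` and `f₀` in their domains there is an event `B`, among the
supports of the `f j` and the conditioning event of `f₀`, on which the supremum (a maximum, since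
`B` is finite and non-empty) of `∑ j, G(f j | X_{I j}) - G(f₀ | z₀)` is non-negative. -/
def JointlyCoherent {T : Type u} {X : T → Type v} {ι : Type*} [Finite ι]
    (M : ι → CondModel X) : Prop :=
  (∀ j, SepCoherent (M j).low) ∧
  ∀ (f : ∀ j, (M j).Dom) (j₀ : ι) (f₀ : (M j₀).Dom) (z₀ : Assign X (M j₀).I),
    ∃ B ∈ insert (cyl z₀) (⋃ j, (M j).support (f j)),
      ∃ ω ∈ B, 0 ≤ (∑ᶠ j, (M j).gain (f j) ω) - (M j₀).gainAt f₀ z₀ ω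

/-! ### The tree -/

section Tree

variable {T : RootedTree.{u}}

/-- The mother of `s`: a singleton, or the empty set when `s` is the root. -/
def mother (s : T) : Set T := {t | t ⋖ s}

/-- The children of `s`. -/
def children (s : T) : Set T := {t | s ⋖ t}

/-- `↓S`: the nodes of `S` together with all their descendants. -/
def after (S : Set T) : Set T := {t | ∃ s ∈ S, s ≤ t}

/-- The common non-parent non-descendants of the nodes in `S`. -/
def nonParNonDesc (S : Set T) : Set T := ⋂ c ∈ S, (mother c ∪ after {c})ᶜ

theorem after_mono {S S' : Set T} (h : S ⊆ S') : after S ⊆ after S' :=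
  fun _ ⟨s, hs, hst⟩ => ⟨s, h hs, hst⟩

theorem subset_after (S : Set T) : S ⊆ after S := fun s hs => ⟨s, hs, le_rfl⟩

theorem mother_subset {s c : T} (h : c ∈ children s) : mother c ⊆ {s} := by
  intro t ht
  have h1 : Order.pred c = s := CovBy.pred_eq h
  have h2 : Order.pred c = t := CovBy.pred_eq ht
  exact h2.symm.trans h1

theorem after_children [Finite T] {s t : T} (ht : t ∈ after {s}) (hne : t ≠ s) :
    t ∈ after (children s) := by
  obtain ⟨r, rfl, hrt⟩ := ht
  obtain ⟨c, hc, hct⟩ := exists_covBy_le_of_lt (lt_of_le_of_ne hrt (Ne.symm hne))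
  exact ⟨c, hc, hct⟩

theorem after_leaf [Finite T] {s : T} (h : ¬ (children s).Nonempty) : after {s} ⊆ {s} := by
  intro t ht
  by_contra hne
  obtain ⟨c, hc, -⟩ := after_children ht hne
  exact h ⟨c, hc⟩

/-- A node together with a non-empty set of its children (so the node is non-terminal). -/
structure Branching (T : RootedTree.{u}) where
  node : T
  sub : Set T
  nonempty : sub.Nonempty
  subset : sub ⊆ children node

/-- A branching `(s, S)` together with a set `R` of common non-parent non-descendants of `S`. -/
structure Irrelevance (T : RootedTree.{u}) where
  br : Branching T
  R : Set T
  subset : R ⊆ nonParNonDesc br.sub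

/-- For a node `s`: disjoint proper subsets `O` and `I` of its set of children, `O` non-empty. -/
structure BlockPair {T : RootedTree.{u}} (s : T) where
  O : Set T
  I : Set T
  nonempty : O.Nonempty
  disjoint : Disjoint O I
  ssubset_O : O ⊂ children s
  ssubset_I : I ⊂ children s

instance [Finite T] : Finite (Branching T) :=
  Finite.of_injective (fun b : Branching T => (b.node, b.sub)) (by
    rintro ⟨_, _, _, _⟩ ⟨_, _, _, _⟩ h
    simp only [Prod.mk.injEq] at h
    obtain ⟨rfl, rfl⟩ := h
    rfl)

instance [Finite T] : Finite (Irrelevance T) :=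
  Finite.of_injective (fun b : Irrelevance T => (b.br, b.R)) (by
    rintro ⟨_, _, _⟩ ⟨_, _, _⟩ h
    simp only [Prod.mk.injEq] at h
    obtain ⟨rfl, rfl⟩ := h
    rfl)

instance [Finite T] (s : T) : Finite (BlockPair s) :=
  Finite.of_injective (fun b : BlockPair s => (b.O, b.I)) (by
    rintro ⟨_, _, _, _, _, _⟩ ⟨_, _, _, _, _, _⟩ h
    simp only [Prod.mk.injEq] at h
    obtain ⟨rfl, rfl⟩ := h
    rfl)

end Tree

section Models

variable {T : RootedTree.{u}} (X : T → Type v)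

/-! ### Conditionally independent natural extension -/

variable {X}

/-- The models that the epistemic independence, conditional on `X_s`, of the `X_{↓c}` for the
children `c` of `s` infers from `R`: given `X_s` and `X_{↓I}`, the model for `X_{↓O}` is the
`X_{↓O}`-marginal of `R` given `X_s` alone. -/
def blockModel {s : T} (R : CondLP X (after (children s)) {s}) (b : BlockPair s) : CondModel X where
  O := after b.O
  I := {s} ∪ after b.I
  low := fun z g => R (Set.domRestrict₂ Set.subset_union_left z)
    (fun y => g (Set.domRestrict₂ (after_mono b.ssubset_O.subset) y))

/-- `R` is a conditionally independent product, given `X_s`, of the conditional lower previsions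
`P c` for the variables `X_{↓c}`, `c` a child of `s`: it extends the `P c`, and it is jointly
coherent with the models that it induces through conditional epistemic independence. -/
def IsCondIndProduct [Finite T] (s : T) (P : ∀ c ∈ children s, CondLP X (after {c}) {s})
    (R : CondLP X (after (children s)) {s}) : Prop :=
  (∀ (c : T) (hc : c ∈ children s) (x : Assign X {s}) (g : Gamble (Assign X (after {c}))),
    R x (fun y => g (Set.domRestrict₂ (after_mono (Set.singleton_subset_iff.2 hc)) y)) = P c hc x g) ∧
  JointlyCoherent (fun j : Option (BlockPair s) => j.elim (CondModel.mk _ _ R) (blockModel R))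

/-- The conditionally independent natural extension of the `P c`: the lower envelope of their
conditionally independent products. -/
noncomputable def condIndNatExt [Finite T] (s : T)
    (P : ∀ c ∈ children s, CondLP X (after {c}) {s}) : CondLP X (after (children s)) {s} :=
  fun x f => sInf {r | ∃ R, IsCondIndProduct s P R ∧ r = R x f}

/-! ### Local models, global models and their recursion -/

variable (X) in
/-- A local model in each node `s`: about `X_s`, conditional on its mother variable. -/
abbrev LocalModels : Type (max u v) := ∀ s : T, CondLP X {s} (mother s)

/-- Put together a value of `X_s` and a value of `X_{↓C(s)}` into a value of `X_{↓s}`. -/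
noncomputable def glue [Finite T] {s : T} (a : Assign X {s}) (w : Assign X (after (children s))) :
    Assign X (after {s}) :=
  open Classical in
  fun t => if h : (t : T) = s then a ⟨t, h⟩ else w ⟨t, after_children t.2 h⟩

/-- The global model for `X_{↓s}` given the mother variable of `s`, by recursion from the leaves to
the root: the local model in a leaf; in a non-terminal node, the marginal extension of the
conditionally independent natural extension of the children's models with the local model. -/
noncomputable def subtreeModel [Finite T] (Q : LocalModels X) (s : T) :
    CondLP X (after {s}) (mother s) :=
  open Classical in
  fun x g =>
    if h : (children s).Nonempty then
      Q s x (fun a => condIndNatExt s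
        (fun c hc z => subtreeModel Q c (Set.domRestrict₂ (mother_subset hc) z)) a
        (fun w => g (glue a w)))
    else Q s x (fun a => g (Set.domRestrict₂ (after_leaf h) a))
termination_by wellFounded_gt.wrap s
decreasing_by exact hc.lt

/-- The model `⊗_{c ∈ C(s)} P_{↓c}(· | X_s)` for `X_{↓C(s)}` given `X_s`. -/
noncomputable def childrenModel [Finite T] (Q : LocalModels X) (s : T) :
    CondLP X (after (children s)) {s} :=
  condIndNatExt s (fun _ hc z => subtreeModel Q _ (Set.domRestrict₂ (mother_subset hc) z))

variable (X) in
/-- A family of global models: a joint lower prevision, and for each non-terminal node `s` and each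
non-empty set `S` of children of `s`, a model for `X_{↓S}` conditional on `X_s`. -/
@[ext] structure TreeFamily where
  joint : Gamble (∀ t, X t) → ℝ
  cond : ∀ b : Branching T, CondLP X (after b.sub) {b.node}

/-- Point-wise order between families. -/
instance : LE (TreeFamily X) := ⟨fun V W => V.joint ≤ W.joint ∧ V.cond ≤ W.cond⟩

/-- The family of global models obtained from the local models. -/
noncomputable def globalModels [Finite T] (Q : LocalModels X) : TreeFamily X where
  joint := fun f => subtreeModel Q (⊥ : T) (fun t => (not_lt_bot t.2.lt).elim)
    (fun y => f (fun t => y ⟨t, ⊥, rfl, bot_le⟩))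
  cond := fun b x g => childrenModel Q b.node x
    (fun y => g (Set.domRestrict₂ (after_mono b.subset) y))

/-! ### The requirements on a family of global models -/

/-- The joint lower prevision as a model conditional on no variables. -/
def jointModel (P : Gamble (∀ t, X t) → ℝ) : CondModel X where
  O := Set.univ
  I := ∅
  low := fun _ g => P (fun ω => g (Set.univ.domRestrict ω))

/-- The members of the family `V`. -/
def TreeFamily.model (V : TreeFamily X) : Option (Branching T) → CondModel X
  | none => jointModel V.joint
  | some b => CondModel.mk _ _ (V.cond b)

/-- The model for `X_{↓S}` given `X_{{s} ∪ R}` that is defined from the family `V` through the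
irrelevance of `X_R` to `X_{↓S}` conditional on `X_s`. -/
def TreeFamily.irrModel (V : TreeFamily X) (i : Irrelevance T) : CondModel X where
  O := after i.br.sub
  I := {i.br.node} ∪ i.R
  low := fun z g => V.cond i.br (Set.domRestrict₂ Set.subset_union_left z) g

/-- T1: the global models extend the local models. -/
def ExtendsLocal (Q : LocalModels X) (V : TreeFamily X) : Prop :=
  (∀ (x : Assign X (mother (⊥ : T))) (f : Gamble (Assign X {(⊥ : T)})),
    V.joint (fun ω => f (Set.domRestrict {(⊥ : T)} ω)) = Q ⊥ x f) ∧
  ∀ (s c : T) (hc : c ∈ children s) (x : Assign X {s}) (f : Gamble (Assign X {c})),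
    V.cond ⟨s, {c}, Set.singleton_nonempty c, Set.singleton_subset_iff.2 hc⟩ x
      (fun y => f (Set.domRestrict₂ (subset_after {c}) y)) =
        Q c (Set.domRestrict₂ (mother_subset hc) x) f

/-- T2: the models in the family are jointly coherent. -/
def FamilyCoherent [Finite T] (V : TreeFamily X) : Prop := JointlyCoherent V.model

/-- T3: the models in the family are jointly coherent with all the models that are defined from
them through the epistemic irrelevances encoded in the tree. -/
def IrrelevanceCoherent [Finite T] (V : TreeFamily X) : Prop :=
  JointlyCoherent (Sum.elim V.model V.irrModel)

/-- T1, T2 and T3 together. -/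
def Admissible [Finite T] (Q : LocalModels X) (V : TreeFamily X) : Prop :=
  ExtendsLocal Q V ∧ FamilyCoherent V ∧ IrrelevanceCoherent V

/-- T4: the family is point-wise dominated by every family that satisfies T1, T2 and T3. -/
def MostConservative [Finite T] (Q : LocalModels X) (V : TreeFamily X) : Prop :=
  ∀ W, Admissible Q W → V ≤ W

/-! ### Regular extension -/

/-- The prices `μ` with `P (1_{X_E = x} (f - μ)) ≥ 0`. -/
def acceptablePrices (P : Gamble (∀ t, X t) → ℝ) {E : Set T} (x : Assign X E)
    (f : Gamble (∀ t, X t)) : Set ℝ :=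
  {μ | 0 ≤ P ((cyl x).indicator (fun ω => f ω - μ))}

/-- Regular extension of the joint `P`, conditional on `X_E`. -/
noncomputable def regularExtension (P : Gamble (∀ t, X t) → ℝ) (E : Set T) (x : Assign X E)
    (f : Gamble (∀ t, X t)) : ℝ :=
  sSup (acceptablePrices P x f)

/-- Regular extension as a model about the variables outside `E`, conditional on `X_E`. -/
noncomputable def regularModel (P : Gamble (∀ t, X t) → ℝ) (E : Set T) : CondModel X where
  O := Eᶜ
  I := E
  low := fun x g => regularExtension P E x (fun ω => g (Eᶜ.domRestrict ω))

end Models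

end CredalTree

open CredalTree

/-!
Joint coherence always comes from one source: models that are all regular extensions of one and the
same coherent lower prevision are jointly coherent (`jointlyCoherent_of_isRegular`). A sum of gains
that violated joint coherence on the conditioning event of `f₀` would make that lower prevision
accept `f₀` at a price above its highest acceptable one.

The conditionally independent natural extension in a node is the lower envelope `natExt` of the
linear previsions that respect the model of each child conditional on all values of the variables
outside that child's subtree. Linear previsions of this kind can be pasted together along a union of
subtrees (`paste_mem`), and they can be conditioned on events about the other subtrees. Hence
`natExt` extends the children's models (`GoodBlocks.natExt_eq`), and multiplying a gamble about some
of the subtrees by a non-negative, non-zero gamble about the other ones preserves whether its lower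
prevision is negative (`GoodBlocks.natExt_mul_nonneg`, `GoodBlocks.natExt_mul_neg`); for the latter,
strict positivity keeps the upper prevision of the non-negative factor positive. So the models that
`natExt` induces are the regular extensions of its lower envelope over all values of the other
variables, and `natExt` is an independent product. It is the smallest one (`childExt_le`), because
joint coherence forces an independent product to accept the gains of each child's model conditional
on the other children
(`JointlyCoherent.lift_sub_nonneg`), and by the Hahn–Banach theorem a coherent lower prevision is
the lower envelope of the linear previsions that dominate it.

The same sign rules, applied in each node on the way to the root (`lift_subtreeModel_nonneg`,
`lift_subtreeModel_neg`), show that the global models, also conditional on further non-parent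
non-descendants, are the regular extensions of the joint (`isRegular_branchModel`). This gives
the coherence of the family with its irrelevance models and with the regular extension of the joint.
An admissible family dominates the global models, by induction from the leaves to the root
(`globalModels_le`): the irrelevance requirement makes its models accept the gains of each child's
model conditional on the siblings' subtrees, and those of the children's model conditional on the
mother variable.
-/

namespace CredalTree

/-! ### Coherent lower previsions and the linear previsions that dominate them -/

section Coherent

variable {Y : Type*} {P : Gamble Y → ℝ}

theorem IsCoherent.nonneg (hP : IsCoherent P) {f : Gamble Y} (hf : 0 ≤ f) : 0 ≤ P f :=
  (Real.iInf_nonneg hf).trans (hP.min_le f)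

theorem IsCoherent.mono (hP : IsCoherent P) {f g : Gamble Y} (h : f ≤ g) : P f ≤ P g := by
  have h1 := hP.superadd f (g - f)
  have h2 := hP.nonneg (f := g - f) (sub_nonneg.2 h)
  rw [add_sub_cancel] at h1
  linarith

theorem IsCoherent.zero (hP : IsCoherent P) : P 0 = 0 := by
  simpa using hP.nonneg_hom 0 0 le_rfl

theorem IsCoherent.add_neg (hP : IsCoherent P) (f : Gamble Y) : P f + P (-f) ≤ 0 := by
  have := hP.superadd f (-f)
  rwa [add_neg_cancel, hP.zero] at this

theorem IsCoherent.const [Nonempty Y] (hP : IsCoherent P) (c : ℝ) : P (fun _ => c) = c := by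
  have h1 := hP.min_le (fun _ => c)
  have h2 := hP.min_le (-fun _ => c)
  have h3 := hP.add_neg (fun _ => c)
  simp only [Pi.neg_apply, ciInf_const] at h1 h2
  linarith

theorem IsCoherent.sub_const [Nonempty Y] (hP : IsCoherent P) (f : Gamble Y) (c : ℝ) :
    P (fun y => f y - c) = P f - c := by
  have h1 := hP.superadd f (fun _ => -c)
  have h2 := hP.superadd (fun y => f y - c) (fun _ => c)
  rw [hP.const] at h1 h2
  have e1 : f + (fun _ => -c) = fun y => f y - c := by ext; simp [sub_eq_add_neg]
  have e2 : (fun y => f y - c) + (fun _ => c) = f := by ext; simp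
  rw [e1] at h1
  rw [e2] at h2
  linarith

theorem IsCoherent.le_of_nonneg_sub (hP : IsCoherent P) {f g : Gamble Y} (h : 0 ≤ P (f - g)) :
    P g ≤ P f := by
  have := hP.superadd (f - g) g
  rw [sub_add_cancel] at this
  linarith

theorem IsCoherent.sum_nonneg (hP : IsCoherent P) {ι : Type*} (s : Finset ι) (f : ι → Gamble Y)
    (h : ∀ i ∈ s, 0 ≤ P (f i)) : 0 ≤ P (∑ i ∈ s, f i) := by
  classical
  induction s using Finset.induction_on with
  | empty => simp [hP.zero]
  | insert a s ha ih =>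
    rw [Finset.sum_insert ha]
    have h1 := hP.superadd (f a) (∑ i ∈ s, f i)
    have h2 := ih fun i hi => h i (Finset.mem_insert_of_mem hi)
    have h3 := h a (Finset.mem_insert_self a s)
    linarith

/-- A lower prevision is negative on every non-positive gamble other than zero when its conjugate
is strictly positive. -/
theorem IsCoherent.neg_of_strictlyPositive (hP : IsCoherent P) (hpos : StrictlyPositive (upper P))
    {f : Gamble Y} (hf : f ≤ 0) {y : Y} (hy : f y < 0) : P f < 0 := by
  have h1 : 0 < -P (-(Set.indicator {y} 1)) := hpos y
  have h2 : f ≤ (-f y) • (-(Set.indicator {y} (1 : Y → ℝ))) := by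
    intro y'
    by_cases h : y' = y
    · subst h; simp
    · simpa [h] using hf y'
  have h3 := hP.mono h2
  rw [hP.nonneg_hom _ _ (by linarith)] at h3
  nlinarith

/-- A linear prevision: a positive normalized linear functional. -/
structure IsLinearPrevision (p : Gamble Y →ₗ[ℝ] ℝ) : Prop where
  nonneg : ∀ f : Gamble Y, 0 ≤ f → 0 ≤ p f
  one : p 1 = 1

theorem IsLinearPrevision.mono {p : Gamble Y →ₗ[ℝ] ℝ} (hp : IsLinearPrevision p) {f g : Gamble Y}
    (h : f ≤ g) : p f ≤ p g := by
  have := hp.nonneg (g - f) (sub_nonneg.2 h)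
  rw [map_sub] at this
  linarith

theorem IsLinearPrevision.const {p : Gamble Y →ₗ[ℝ] ℝ} (hp : IsLinearPrevision p) (c : ℝ) :
    p (fun _ => c) = c := by
  have : (fun _ : Y => c) = c • (1 : Gamble Y) := by ext; simp
  rw [this, map_smul, hp.one, smul_eq_mul, mul_one]

theorem IsLinearPrevision.iInf_le [Finite Y] {p : Gamble Y →ₗ[ℝ] ℝ} (hp : IsLinearPrevision p)
    (f : Gamble Y) : ⨅ y, f y ≤ p f := by
  rw [← hp.const (⨅ y, f y)]
  exact hp.mono fun y => ciInf_le (Set.finite_range f).bddBelow y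

/-- The Hahn–Banach theorem: a coherent lower prevision is the lower envelope of the linear
previsions that dominate it, and the envelope is attained at each gamble. -/
theorem IsCoherent.exists_linear [Nonempty Y] (hP : IsCoherent P) (f : Gamble Y) :
    ∃ p : Gamble Y →ₗ[ℝ] ℝ, IsLinearPrevision p ∧ (∀ g, P g ≤ p g) ∧ p f = P f := by
  have key : ∀ f : Gamble Y, f ≠ 0 →
      ∃ p : Gamble Y →ₗ[ℝ] ℝ, IsLinearPrevision p ∧ (∀ g, P g ≤ p g) ∧ p f = P f := by
    intro f hf
    obtain ⟨p, hp1, hp2⟩ := exists_extension_of_le_sublinear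
      (LinearPMap.mkSpanSingleton (σ := RingHom.id ℝ) f (P f) hf) (fun g => -P (-g))
      (fun c hc g => by
        have := hP.nonneg_hom c (-g) hc.le
        rw [smul_neg] at this
        simp only [this]; ring)
      (fun g h => by
        have := hP.superadd (-g) (-h)
        rw [neg_add]
        linarith)
      (by
        rintro ⟨x, hx⟩
        obtain ⟨c, rfl⟩ := Submodule.mem_span_singleton.1 hx
        rw [show LinearPMap.mkSpanSingleton (σ := RingHom.id ℝ) f (P f) hf ⟨c • f, hx⟩ = c • P f from
          LinearPMap.mkSpanSingleton'_apply _ _ _ _ _]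
        simp only [smul_eq_mul]
        rcases le_total 0 c with hc | hc
        · have h1 := hP.nonneg_hom c (-f) hc
          rw [smul_neg] at h1
          have h2 := hP.add_neg f
          rw [h1]
          nlinarith
        · have h1 := hP.nonneg_hom (-c) f (by linarith)
          rw [neg_smul] at h1
          rw [h1]
          linarith)
    have hdom : ∀ g, P g ≤ p g := fun g => by
      have := hp2 (-g)
      simp only [neg_neg, map_neg] at this
      linarith
    refine ⟨p, ⟨fun g hg => (hP.nonneg hg).trans (hdom g), ?_⟩, hdom, ?_⟩
    · apply le_antisymm
      · have := hdom (-1)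
        rw [map_neg] at this
        have h := hP.const (-1)
        have e : (-1 : Gamble Y) = fun _ => -1 := rfl
        rw [e, h] at this
        linarith
      · rw [← hP.const 1]; exact hdom 1
    · have := hp1 ⟨f, Submodule.mem_span_singleton_self f⟩
      rw [this]
      exact LinearPMap.mkSpanSingleton_apply ℝ ℝ hf (P f)
  by_cases hf : f = 0
  · obtain ⟨p, h1, h2, -⟩ := key 1 one_ne_zero
    exact ⟨p, h1, h2, by rw [hf, map_zero, hP.zero]⟩
  · exact key f hf

/-- Fubini's theorem for linear functionals on the gambles on finite sets. -/
theorem linear_swap {Z : Type*} [Finite Y] [Finite Z] (p : Gamble Y →ₗ[ℝ] ℝ)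
    (q : Gamble Z →ₗ[ℝ] ℝ) (F : Y → Z → ℝ) :
    p (fun y => q (F y)) = q (fun z => p (fun y => F y z)) := by
  classical
  have := Fintype.ofFinite Y
  have := Fintype.ofFinite Z
  have e : ∀ y, q (F y) = ∑ z, F y z * q fun j => if z = j then 1 else 0 := fun y =>
    LinearMap.pi_apply_eq_sum_univ q (F y)
  rw [funext e, LinearMap.pi_apply_eq_sum_univ q, show (fun y => ∑ z, F y z *
    q fun j => if z = j then 1 else 0) = ∑ z, (q fun j => if z = j then 1 else 0) •
      (fun y => F y z) by ext y; simp [mul_comm], map_sum]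
  exact Finset.sum_congr rfl fun z _ => by rw [map_smul, smul_eq_mul, smul_eq_mul, mul_comm]

end Coherent

/-! ### Overwriting some coordinates of a point, and lifting functionals -/

section Patch

variable {T : Type u} {X : T → Type v}

/-- The point `ω` with its coordinates in `O` replaced by those of `w`. -/
noncomputable def patch {O : Set T} (ω : ∀ t, X t) (w : Assign X O) : ∀ t, X t :=
  open Classical in fun t => if h : t ∈ O then w ⟨t, h⟩ else ω t

theorem patch_of_mem {O : Set T} (ω : ∀ t, X t) (w : Assign X O) {t : T} (h : t ∈ O) :
    patch ω w t = w ⟨t, h⟩ := dif_pos h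

theorem patch_of_notMem {O : Set T} (ω : ∀ t, X t) (w : Assign X O) {t : T} (h : t ∉ O) :
    patch ω w t = ω t := dif_neg h

@[simp] theorem domRestrict_patch {O : Set T} (ω : ∀ t, X t) (w : Assign X O) :
    O.domRestrict (patch ω w) = w := by
  funext t
  exact patch_of_mem ω w t.2

theorem domRestrict_patch_of_disjoint {O I : Set T} (h : Disjoint O I) (ω : ∀ t, X t)
    (w : Assign X O) : I.domRestrict (patch ω w) = I.domRestrict ω := by
  funext t
  exact patch_of_notMem ω w (Set.disjoint_right.1 h t.2)

theorem patch_domRestrict_apply {O : Set T} (ω ω' : ∀ t, X t) {t : T} (h : t ∈ O) :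
    patch ω (O.domRestrict ω') t = ω' t := patch_of_mem _ _ h

theorem patch_domRestrict_self {O : Set T} (ω : ∀ t, X t) : patch ω (O.domRestrict ω) = ω := by
  funext t
  by_cases h : t ∈ O
  · rw [patch_domRestrict_apply _ _ h]
  · rw [patch_of_notMem _ _ h]

/-- A functional on the gambles on `X_O`, applied to a gamble on the joint possibility space with
the coordinates outside `O` fixed. -/
noncomputable def blockLift {O : Set T} (P : Gamble (Assign X O) → ℝ) (f : Gamble (∀ t, X t)) :
    Gamble (∀ t, X t) :=
  fun ω => P (fun w => f (patch ω w))

/-- A conditional lower prevision as an operator on the gambles on the joint possibility space. -/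
noncomputable def lift {O I : Set T} (V : CondLP X O I) (f : Gamble (∀ t, X t)) :
    Gamble (∀ t, X t) :=
  fun ω => V (I.domRestrict ω) (fun w => f (patch ω w))

end Patch

/-! ### The independent natural extension of blocks of variables -/

section Blocks

variable {T : Type u} {X : T → Type v}

theorem patch_patch {O : Set T} (ω : ∀ t, X t) (w w' : Assign X O) :
    patch (patch ω w) w' = patch ω w' := by
  funext t
  by_cases h : t ∈ O <;> simp [patch, h]

theorem patch_patch_of_subset {B O : Set T} (h : B ⊆ O) (ω ω' : ∀ t, X t) (w : Assign X B) :
    patch (patch ω' (O.domRestrict ω)) w = patch ω' (O.domRestrict (patch ω w)) := by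
  funext t
  by_cases hB : t ∈ B
  · simp [patch, hB, h hB]
  · by_cases hO : t ∈ O <;> simp [patch, hO, hB]

theorem patch_patch_of_disjoint {B O : Set T} (h : Disjoint B O) (ω ω' : ∀ t, X t)
    (w : Assign X B) :
    patch (patch ω' (O.domRestrict ω)) w = patch (patch ω' w) (O.domRestrict ω) := by
  funext t
  by_cases hB : t ∈ B
  · simp [patch, hB, Set.disjoint_left.1 h hB]
  · by_cases hO : t ∈ O <;> simp [patch, hO, hB]

/-- `p` gives positive probability to the point `y`. -/
def Charges {Y : Type*} (p : Gamble Y → ℝ) (y : Y) : Prop :=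
  ∀ f : Gamble Y, 0 ≤ f → 0 < f y → 0 < p f

variable {κ : Type*} {B : κ → Set T}

/-- The linear previsions on the joint possibility space that respect, for each block `k` in `A`,
the lower prevision `P k` conditional on all values of the variables outside that block. -/
def irrelevantCredal (P : ∀ k, Gamble (Assign X (B k)) → ℝ) (A : Set κ) :
    Set (Gamble (∀ t, X t) →ₗ[ℝ] ℝ) :=
  {p | IsLinearPrevision p ∧ ∀ k ∈ A, ∀ h, p (blockLift (P k) h) ≤ p h}

/-- The lower envelope of the linear previsions that respect each of the `P k` conditional on the
variables outside block `k`. On the gambles that depend on the variables in the blocks only, this is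
the independent natural extension of the `P k`. -/
noncomputable def natExt (P : ∀ k, Gamble (Assign X (B k)) → ℝ) (f : Gamble (∀ t, X t)) : ℝ :=
  ⨅ p : irrelevantCredal P Set.univ, (p : Gamble (∀ t, X t) →ₗ[ℝ] ℝ) f

/-- The linear prevision under which the variables in `O` behave as under `p`, independently of the
variables outside `O`, which behave as under `q`. -/
noncomputable def paste (O : Set T) (p q : Gamble (∀ t, X t) →ₗ[ℝ] ℝ) :
    Gamble (∀ t, X t) →ₗ[ℝ] ℝ where
  toFun f := p (fun ω => q (fun ω' => f (patch ω' (O.domRestrict ω))))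
  map_add' f g := by
    rw [← map_add]
    congr 1
    funext ω
    exact map_add q _ _
  map_smul' c f := by
    rw [← map_smul]
    congr 1
    funext ω
    exact map_smul q _ _

theorem paste_apply (O : Set T) (p q : Gamble (∀ t, X t) →ₗ[ℝ] ℝ) (f : Gamble (∀ t, X t)) :
    paste O p q f = p (fun ω => q (fun ω' => f (patch ω' (O.domRestrict ω)))) := rfl

theorem IsLinearPrevision.paste (O : Set T) {p q : Gamble (∀ t, X t) →ₗ[ℝ] ℝ}
    (hp : IsLinearPrevision p) (hq : IsLinearPrevision q) :
    IsLinearPrevision (paste O p q) where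
  nonneg _ hf := hp.nonneg _ fun ω => hq.nonneg _ fun ω' => hf (patch ω' (O.domRestrict ω))
  one := by
    rw [paste_apply]
    have h : q (fun _ => (1 : ℝ)) = 1 := hq.one
    simp only [Pi.one_apply, h]
    exact hp.one

theorem Charges.paste (O : Set T) {p q : Gamble (∀ t, X t) →ₗ[ℝ] ℝ} {ω : ∀ t, X t}
    (hq' : IsLinearPrevision q) (hp : Charges p ω) (hq : Charges q ω) :
    Charges (paste O p q) ω := by
  intro f hf hω
  refine hp _ (fun ω => hq'.nonneg _ fun ω' => hf (patch ω' (O.domRestrict ω)))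
    (hq _ (fun ω' => hf (patch ω' (O.domRestrict ω))) ?_)
  rwa [patch_domRestrict_self]

theorem paste_of_dependsOn {O : Set T} (p : Gamble (∀ t, X t) →ₗ[ℝ] ℝ)
    {q : Gamble (∀ t, X t) →ₗ[ℝ] ℝ} (hq : IsLinearPrevision q) {f : Gamble (∀ t, X t)}
    (hf : DependsOn f O) : paste O p q f = p f := by
  rw [paste_apply]
  congr 1
  funext ω
  rw [← hq.const (f ω)]
  congr 1
  funext ω'
  exact hf (x := patch ω' (O.domRestrict ω)) fun t ht => patch_domRestrict_apply _ _ ht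

/-- A linear prevision that dominates `P k`, with the variables outside block `k` fixed. -/
theorem fixOutside_mem {P : ∀ k, Gamble (Assign X (B k)) → ℝ} {k : κ} (ω : ∀ t, X t)
    {p : Gamble (Assign X (B k)) →ₗ[ℝ] ℝ}
    (hp : IsLinearPrevision p) (hpP : ∀ g, P k g ≤ p g) :
    p ∘ₗ LinearMap.funLeft ℝ ℝ (fun w : Assign X (B k) => patch ω w) ∈ irrelevantCredal P {k} := by
  refine ⟨⟨fun f hf => hp.nonneg _ fun _ => hf _, hp.one⟩, ?_⟩
  intro l hl h
  obtain rfl : l = k := hl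
  have e : LinearMap.funLeft ℝ ℝ (fun w : Assign X (B l) => patch ω w) (blockLift (P l) h) =
      fun _ => P l (fun w => h (patch ω w)) := by
    funext w
    simp [LinearMap.funLeft_apply, blockLift, patch_patch]
  rw [LinearMap.comp_apply, e, hp.const]
  exact hpP _

theorem exists_charges_dominating [∀ t, Nonempty (X t)]
    {P : ∀ k, Gamble (Assign X (B k)) → ℝ} {k : κ} (hP : IsCoherent (P k))
    (hpos : StrictlyPositive (upper (P k))) (y : Assign X (B k)) :
    ∃ p : Gamble (Assign X (B k)) →ₗ[ℝ] ℝ,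
      IsLinearPrevision p ∧ (∀ g, P k g ≤ p g) ∧ Charges p y := by
  obtain ⟨p, hp, hpP, he⟩ := hP.exists_linear (-(Set.indicator {y} 1))
  refine ⟨p, hp, hpP, fun f hf hy => ?_⟩
  have h1 : 0 < p (Set.indicator {y} 1) := by
    have h : 0 < -P k (-(Set.indicator {y} 1)) := hpos y
    rw [← he, map_neg, neg_neg] at h
    exact h
  have h2 : f y • (Set.indicator {y} (1 : Assign X (B k) → ℝ)) ≤ f := by
    intro y'
    by_cases h : y' = y
    · subst h; simp
    · simpa [h] using hf y'
  have h3 := hp.mono h2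
  rw [map_smul, smul_eq_mul] at h3
  nlinarith

variable [Finite T] [∀ t, Finite (X t)] {P : ∀ k, Gamble (Assign X (B k)) → ℝ}

/-- Pasting preserves the constraints of the blocks inside `O` that the first linear prevision
respects, and those of the blocks outside `O` that the second one respects. -/
theorem paste_mem {O : Set T} {A A' A'' : Set κ} {p q : Gamble (∀ t, X t) →ₗ[ℝ] ℝ}
    (hp : p ∈ irrelevantCredal P A) (hq : q ∈ irrelevantCredal P A')
    (h : ∀ k ∈ A'', (B k ⊆ O ∧ k ∈ A) ∨ (Disjoint (B k) O ∧ k ∈ A')) :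
    paste O p q ∈ irrelevantCredal P A'' := by
  refine ⟨hp.1.paste O hq.1, fun k hk f => ?_⟩
  rcases h k hk with ⟨hk, hA⟩ | ⟨hk, hA⟩
  · rw [paste_apply, paste_apply, linear_swap, linear_swap p q]
    refine hq.1.mono fun ω' => ?_
    simp only [blockLift, patch_patch_of_subset hk]
    exact hp.2 k hA (fun ω => f (patch ω' (O.domRestrict ω)))
  · rw [paste_apply, paste_apply]
    refine hp.1.mono fun ω => ?_
    simp only [blockLift, patch_patch_of_disjoint hk]
    exact hq.2 k hA (fun ω' => f (patch ω' (O.domRestrict ω)))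

theorem natExt_le {p : Gamble (∀ t, X t) →ₗ[ℝ] ℝ} (hp : p ∈ irrelevantCredal P Set.univ)
    (f : Gamble (∀ t, X t)) : natExt P f ≤ p f := by
  refine ciInf_le (f := fun p : irrelevantCredal P Set.univ =>
    (p : Gamble (∀ t, X t) →ₗ[ℝ] ℝ) f) ⟨⨅ ω, f ω, ?_⟩ ⟨p, hp⟩
  rintro _ ⟨p, rfl⟩
  exact p.2.1.iInf_le f

variable [∀ t, Nonempty (X t)] [Finite κ]

/-- Pasting, one block at a time, linear previsions that give positive probability to a point. -/
theorem exists_mem_charges (hB : Pairwise fun k l => Disjoint (B k) (B l))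
    (hP : ∀ k, IsCoherent (P k)) (hpos : ∀ k, StrictlyPositive (upper (P k))) (ω : ∀ t, X t) :
    ∃ p ∈ irrelevantCredal P Set.univ, Charges p ω := by
  classical
  have := Fintype.ofFinite κ
  suffices h : ∀ A : Finset κ, ∃ p ∈ irrelevantCredal P (A : Set κ), Charges p ω by
    simpa using h Finset.univ
  intro A
  induction A using Finset.induction_on with
  | empty =>
    refine ⟨LinearMap.proj ω, ?_, fun f _ h => h⟩
    exact ⟨⟨fun _ hf => hf ω, rfl⟩, fun _ h => by simp at h⟩
  | insert k A hk ih =>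
    obtain ⟨q, hq, hqω⟩ := ih
    obtain ⟨p, hp, hpP, hpω⟩ :=
      exists_charges_dominating (hP k) (hpos k) ((B k).domRestrict ω)
    refine ⟨_, paste_mem (O := B k) (fixOutside_mem ω hp hpP) hq ?_,
      Charges.paste _ hq.1 (fun f hf h => hpω _ (fun _ => hf _) ?_) hqω⟩
    · intro l hl
      by_cases hlk : l = k
      · exact Or.inl ⟨hlk ▸ subset_rfl, hlk⟩
      · exact Or.inr ⟨hB hlk, by simpa [hlk] using hl⟩
    · rwa [LinearMap.funLeft_apply, patch_domRestrict_self]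

/-- The hypotheses under which blocks of variables have a well-behaved independent natural
extension: they are disjoint, and their lower previsions are coherent with strictly positive
conjugates. -/
structure GoodBlocks (P : ∀ k, Gamble (Assign X (B k)) → ℝ) : Prop where
  disjoint : Pairwise fun k l => Disjoint (B k) (B l)
  coherent : ∀ k, IsCoherent (P k)
  pos : ∀ k, StrictlyPositive (upper (P k))

namespace GoodBlocks

theorem nonempty_credal (h : GoodBlocks P) : Nonempty (irrelevantCredal P Set.univ) := by
  obtain ⟨p, hp, -⟩ := exists_mem_charges h.disjoint h.coherent h.pos (Classical.arbitrary _)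
  exact ⟨p, hp⟩

theorem le_natExt (h : GoodBlocks P) {f : Gamble (∀ t, X t)} {c : ℝ}
    (hc : ∀ p ∈ irrelevantCredal P Set.univ, c ≤ p f) : c ≤ natExt P f :=
  have := h.nonempty_credal
  le_ciInf fun p => hc p p.2

theorem exists_lt_of_natExt_lt (h : GoodBlocks P) {f : Gamble (∀ t, X t)} {c : ℝ}
    (hc : natExt P f < c) :
    ∃ p ∈ irrelevantCredal P Set.univ, p f < c := by
  by_contra! hcon
  exact absurd (h.le_natExt hcon) (not_le.2 hc)

theorem isCoherent_natExt (h : GoodBlocks P) : IsCoherent (natExt P) where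
  min_le f := h.le_natExt fun p hp => hp.1.iInf_le f
  superadd f g := h.le_natExt fun p hp => by
    rw [map_add]
    exact add_le_add (natExt_le hp f) (natExt_le hp g)
  nonneg_hom c f hc := by
    have := h.nonempty_credal
    rw [natExt, natExt, Real.mul_iInf_of_nonneg hc]
    simp

/-- The independent natural extension is an extension. -/
theorem natExt_eq (h : GoodBlocks P) (k : κ) {f : Gamble (∀ t, X t)} (hf : DependsOn f (B k))
    (ω : ∀ t, X t) :
    natExt P f = P k (fun w => f (patch ω w)) := by
  apply le_antisymm
  · obtain ⟨p, hp, hpP, he⟩ := (h.coherent k).exists_linear (fun w => f (patch ω w))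
    obtain ⟨q, hq⟩ := h.nonempty_credal
    rw [← he]
    have hmem := fixOutside_mem ω hp hpP
    refine (natExt_le (paste_mem (O := B k) (A'' := Set.univ) hmem hq ?_) f).trans (le_of_eq ?_)
    · intro l _
      by_cases hlk : l = k
      · exact Or.inl ⟨hlk ▸ subset_rfl, hlk⟩
      · exact Or.inr ⟨h.disjoint hlk, trivial⟩
    · rw [paste_of_dependsOn _ hq.1 hf]
      rfl
  · refine h.le_natExt fun p hp => ?_
    have h2 := hp.2 k trivial f
    rwa [show blockLift (P k) f = fun _ => P k (fun w => f (patch ω w)) from ?_, hp.1.const] at h2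
    funext ω'
    refine congrArg (P k) (funext fun w => hf (x := patch ω' w) fun t ht => ?_)
    rw [patch_of_mem _ _ ht, patch_of_mem _ _ ht]

/-- Conditioning on an event about the variables outside `O` keeps the sign of a lower prevision of
a gamble about the variables in `O`: a linear prevision that respects the blocks in `O`
still does so after it is conditioned. -/
theorem natExt_mul_nonneg (h : GoodBlocks P) {O : Set T} (hO : ∀ k, B k ⊆ O ∨ Disjoint (B k) O)
    {f g : Gamble (∀ t, X t)} (hf : DependsOn f O) (hg : DependsOn g Oᶜ) (hg0 : 0 ≤ g)
    (hE : 0 ≤ natExt P f) : 0 ≤ natExt P (g * f) := by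
  refine h.le_natExt fun p hp => ?_
  obtain hpg | hpg := (hp.1.nonneg g hg0).eq_or_lt
  · -- If `p g = 0` then `p (g * f) = 0`, as `g * f` is bounded by a multiple of `g`.
    have h1 : (⨅ ω, f ω) • g ≤ g * f := fun ω => by
      have := ciInf_le (Set.finite_range f).bddBelow ω
      have := hg0 ω
      simp only [Pi.smul_apply, Pi.mul_apply, smul_eq_mul, Pi.zero_apply] at *
      nlinarith
    have := hp.1.mono h1
    rwa [map_smul, ← hpg, smul_zero] at this
  · -- Otherwise `p` conditional on `g` respects the blocks in `O`.
    let pg : Gamble (∀ t, X t) →ₗ[ℝ] ℝ := (p g)⁻¹ • (p ∘ₗ LinearMap.mulLeft ℝ g)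
    have hpg_apply : ∀ f, pg f = (p g)⁻¹ * p (g * f) := fun _ => rfl
    have hmem : pg ∈ irrelevantCredal P {k | B k ⊆ O} := by
      refine ⟨⟨fun f hf => ?_, ?_⟩, fun k hk f => ?_⟩
      · rw [hpg_apply]
        exact mul_nonneg (inv_nonneg.2 hpg.le) (hp.1.nonneg _ (mul_nonneg hg0 hf))
      · rw [hpg_apply, mul_one, inv_mul_cancel₀ hpg.ne']
      · rw [hpg_apply, hpg_apply]
        refine mul_le_mul_of_nonneg_left ?_ (inv_nonneg.2 hpg.le)
        have e : g * blockLift (P k) f = blockLift (P k) (g * f) := by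
          funext ω
          have e2 : (fun w : Assign X (B k) => (g * f) (patch ω w)) =
              g ω • fun w => f (patch ω w) := by
            funext w
            rw [Pi.mul_apply, Pi.smul_apply, smul_eq_mul, hg (y := ω)]
            intro t ht
            exact patch_of_notMem _ _ fun hk' => ht (hk hk')
          rw [Pi.mul_apply, blockLift, blockLift, e2, (h.coherent k).nonneg_hom _ _ (hg0 ω)]
        rw [e]
        exact hp.2 k trivial _
    have h2 := natExt_le (paste_mem (O := O) (A'' := Set.univ) hmem hp (fun k _ => by
      rcases hO k with hk | hk
      · exact Or.inl ⟨hk, hk⟩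
      · exact Or.inr ⟨hk, trivial⟩)) f
    rw [paste_of_dependsOn _ hp.1 hf, hpg_apply] at h2
    exact nonneg_of_mul_nonneg_right (hE.trans h2) (inv_pos.2 hpg)

/-- Pasting a linear prevision with a negative value on `f` to one with a positive value on `g`
gives a negative value on the product. -/
theorem natExt_mul_neg (h : GoodBlocks P) {O : Set T} (hO : ∀ k, B k ⊆ O ∨ Disjoint (B k) O)
    {f g : Gamble (∀ t, X t)} (hf : DependsOn f O) (hg : DependsOn g Oᶜ) (hg0 : 0 ≤ g)
    {ω : ∀ t, X t} (hω : 0 < g ω) (hE : natExt P f < 0) : natExt P (g * f) < 0 := by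
  obtain ⟨p, hp, hpf⟩ := h.exists_lt_of_natExt_lt hE
  obtain ⟨q, hq, hqω⟩ := exists_mem_charges h.disjoint h.coherent h.pos ω
  refine (natExt_le (paste_mem (O := O) hp hq fun k hk => (hO k).imp
    (fun h => ⟨h, hk⟩) (fun h => ⟨h, hk⟩)) _).trans_lt ?_
  rw [paste_apply]
  have e : (fun ω => q fun ω' => (g * f) (patch ω' (O.domRestrict ω))) = q g • f := by
    funext ω
    rw [show (fun ω' => (g * f) (patch ω' (O.domRestrict ω))) = f ω • g from ?_, map_smul]
    · exact mul_comm _ _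
    · funext ω'
      rw [Pi.mul_apply, Pi.smul_apply, smul_eq_mul, mul_comm,
        hf (y := ω) (fun t ht => patch_domRestrict_apply _ _ ht),
        hg (y := ω') (fun t ht => patch_of_notMem _ _ ht)]
  rw [e, map_smul, smul_eq_mul]
  exact mul_neg_of_pos_of_neg (hqω g hg0 hω) hpf

/-- A gamble that is nowhere positive and somewhere negative has a negative lower prevision. -/
theorem natExt_neg (h : GoodBlocks P) {f : Gamble (∀ t, X t)} (hf : f ≤ 0) {ω : ∀ t, X t}
    (hω : f ω < 0) :
    natExt P f < 0 := by
  obtain ⟨q, hq, hqω⟩ := exists_mem_charges h.disjoint h.coherent h.pos ω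
  refine (natExt_le hq f).trans_lt ?_
  have := hqω (-f) (by simpa using hf) (by simpa using hω)
  rw [map_neg] at this
  linarith

/-- A coherent lower prevision on the gambles about the variables in a union `A` of blocks dominates
the natural extension as soon as it accepts the gains of each block in `A` conditional on the
variables outside that block: the linear previsions that dominate it respect the blocks in `A`. -/
theorem natExt_le_of_accepts (h : GoodBlocks P) {A : Set T} (hA : ∀ k, B k ⊆ A ∨ Disjoint (B k) A)
    {V : Gamble (Assign X A) → ℝ} (hV : IsCoherent V) (ω : ∀ t, X t)
    (hacc : ∀ k, B k ⊆ A → ∀ f : Gamble (∀ t, X t),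
      0 ≤ V (fun w => f (patch ω w) - blockLift (P k) f (patch ω w)))
    {f : Gamble (∀ t, X t)} (hf : DependsOn f A) :
    natExt P f ≤ V (fun w => f (patch ω w)) := by
  obtain ⟨p, hp, hpV, he⟩ := hV.exists_linear (fun w => f (patch ω w))
  obtain ⟨q, hq⟩ := h.nonempty_credal
  have hmem : p ∘ₗ LinearMap.funLeft ℝ ℝ (fun w : Assign X A => patch ω w) ∈
      irrelevantCredal P {k | B k ⊆ A} := by
    refine ⟨⟨fun f hf => hp.nonneg _ fun _ => hf _, hp.one⟩, fun k hk f => ?_⟩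
    have := (hacc k hk f).trans (hpV _)
    rw [show (fun w => f (patch ω w) - blockLift (P k) f (patch ω w)) =
      (fun w => f (patch ω w)) - fun w => blockLift (P k) f (patch ω w) from rfl, map_sub] at this
    exact sub_nonneg.1 this
  refine (natExt_le (paste_mem (O := A) (A'' := Set.univ) hmem hq fun k hk => (hA k).imp
    (fun h => ⟨h, h⟩) (fun h => ⟨h, hk⟩)) f).trans (le_of_eq ?_)
  rw [← he, paste_of_dependsOn _ hq.1 hf]
  rfl

end GoodBlocks

end Blocks

/-! ### Joint coherence -/

section JointCoherence

variable {T : Type u} {X : T → Type v}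

/-- `M` is the regular extension of `P`: the lower prevision of `f` given `z` is the highest price
`μ` such that `P` accepts `f - μ` contingent on `z`. -/
def IsRegular (P : Gamble (∀ t, X t) → ℝ) (M : CondModel X) : Prop :=
  ∀ (f : M.Dom) (z : Assign X M.I), 0 ≤ P (M.gainAt f z) ∧
    ∀ ε : ℝ, 0 < ε → P (M.gainAt f z - (cyl z).indicator (fun _ => ε)) < 0

theorem CondModel.gain_eq_sum (M : CondModel X) [Fintype (Assign X M.I)] (f : M.Dom) :
    M.gain f = ∑ z, M.gainAt f z := by
  classical
  funext ω
  rw [Finset.sum_apply, Finset.sum_eq_single (M.I.domRestrict ω)]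
  · exact (Set.indicator_of_mem (s := cyl (M.I.domRestrict ω)) rfl _).symm
  · intro z _ hz
    exact Set.indicator_of_notMem (s := cyl z) (fun h => hz h.symm) _
  · simp

theorem CondModel.gain_of_eq_zero {M : CondModel X} (hM : SepCoherent M.low) {f : M.Dom}
    {ω : ∀ t, X t} (h : f (M.I.domRestrict ω) = 0) : M.gain f ω = 0 := by
  simp [CondModel.gain, h, (hM _).zero]

theorem CondModel.gain_mem_support {M : CondModel X} (hM : SepCoherent M.low) {f : M.Dom}
    {ω : ∀ t, X t} (h : M.gain f ω ≠ 0) : cyl (M.I.domRestrict ω) ∈ M.support f :=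
  ⟨_, fun h0 => h (M.gain_of_eq_zero hM h0), rfl⟩

/-- Separately coherent models that are all regular extensions of one and the same coherent lower
prevision are jointly coherent: a sum of gains that violates joint coherence on the conditioning
event of `f₀` would let the joint accept `f₀` at a price above its highest acceptable one. -/
theorem jointlyCoherent_of_isRegular [Finite T] [∀ t, Finite (X t)]
    {P : Gamble (∀ t, X t) → ℝ} (hP : IsCoherent P) {ι : Type*} [Finite ι] {M : ι → CondModel X}
    (hM : ∀ j, SepCoherent (M j).low) (hreg : ∀ j, IsRegular P (M j)) : JointlyCoherent M := by
  classical
  have := Fintype.ofFinite ι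
  have : ∀ j, Fintype (Assign X (M j).I) := fun j => Fintype.ofFinite _
  refine ⟨hM, fun f j₀ f₀ z₀ => ?_⟩
  by_contra! hcon
  simp only [finsum_eq_sum_of_fintype] at hcon
  set h : Gamble (∀ t, X t) := ∑ j, (M j).gain (f j) with hh
  have hsum : ∀ ω, ∑ j, (M j).gain (f j) ω = h ω := fun ω => by rw [hh, Finset.sum_apply]
  simp only [hsum] at hcon
  have hPh : 0 ≤ P h := by
    refine hP.sum_nonneg _ _ fun j _ => ?_
    rw [CondModel.gain_eq_sum]
    exact hP.sum_nonneg _ _ fun z _ => (hreg j (f j) z).1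
  obtain ⟨δ, hδ, hδle⟩ : ∃ δ > 0, ∀ ω ∈ cyl z₀, h ω - (M j₀).gainAt f₀ z₀ ω ≤ -δ := by
    rcases (cyl z₀).eq_empty_or_nonempty with he | hne
    · exact ⟨1, one_pos, by simp [he]⟩
    · obtain ⟨ω, hω, hmax⟩ := Set.exists_max_image (cyl z₀)
        (fun ω => h ω - (M j₀).gainAt f₀ z₀ ω) (Set.toFinite _) hne
      exact ⟨-(h ω - (M j₀).gainAt f₀ z₀ ω), neg_pos.2 (hcon _ (Set.mem_insert _ _) ω hω),
        fun ω' hω' => by simpa using hmax ω' hω'⟩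
  refine absurd ((hreg j₀ f₀ z₀).2 δ hδ) (not_lt.2 (hPh.trans (hP.mono fun ω => ?_)))
  by_cases hω : ω ∈ cyl z₀
  · have := hδle ω hω
    rw [Pi.sub_apply, Set.indicator_of_mem hω]
    linarith
  · have h0 : (M j₀).gainAt f₀ z₀ ω = 0 := Set.indicator_of_notMem hω _
    rw [Pi.sub_apply, Set.indicator_of_notMem hω, h0, sub_zero]
    by_cases hall : ∀ j, (M j).gain (f j) ω = 0
    · rw [← hsum]
      exact (Finset.sum_eq_zero fun j _ => hall j).le
    · obtain ⟨j, hj⟩ := not_forall.1 hall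
      have := hcon _ (Set.mem_insert_of_mem _ (Set.mem_iUnion.2
        ⟨j, CondModel.gain_mem_support (hM j) hj⟩)) ω rfl
      rw [h0, sub_zero] at this
      exact this.le

/-- A consequence of joint coherence: when the variables of `M j₁` are those of `M j₀` and its
conditioning variables include those of `M j₀`, then `M j₀` accepts the gains of `M j₁`. -/
theorem JointlyCoherent.lift_sub_nonneg {ι : Type*} [Finite ι] {M : ι → CondModel X}
    (hM : JointlyCoherent M) (j₀ j₁ : ι) (hI : (M j₀).I ⊆ (M j₁).I)
    (hO : (M j₀).O ∪ (M j₀).I = (M j₁).O ∪ (M j₁).I) (h : Gamble (∀ t, X t)) (ω₀ : ∀ t, X t) :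
    0 ≤ lift (M j₀).low (h - lift (M j₁).low h) ω₀ := by
  classical
  have := Fintype.ofFinite ι
  set z₀ := (M j₀).I.domRestrict ω₀ with hz₀
  let f₁ : (M j₁).Dom := fun z y =>
    if Set.domRestrict₂ hI z = z₀ then h (patch (patch ω₀ z) y) else 0
  let f₀ : (M j₀).Dom := fun _ w => (h - lift (M j₁).low h) (patch ω₀ w)
  let f : ∀ j, (M j).Dom := Function.update 0 j₁ f₁
  obtain ⟨B, hB, ω, hω, hle⟩ := hM.2 f j₀ f₀ z₀
  have hωz : ω ∈ cyl z₀ := by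
    rcases hB with rfl | hB
    · exact hω
    · obtain ⟨j, z, hz, rfl⟩ := Set.mem_iUnion.1 hB
      by_cases hj : j = j₁
      · subst hj
        have hz' : f₁ z ≠ 0 := by simpa [f] using hz
        have hzz : Set.domRestrict₂ hI z = z₀ := by
          by_contra hne
          exact hz' (funext fun y => if_neg hne)
        rw [← hzz]
        obtain rfl : (M j).I.domRestrict ω = z := hω
        rfl
      · exact absurd (by simp [f, hj]) hz
  have hωz' : ∀ t ∈ (M j₀).I, ω t = ω₀ t := fun t ht => congrFun hωz ⟨t, ht⟩
  have hsum : ∑ᶠ j, (M j).gain (f j) ω = (M j₁).gain f₁ ω := by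
    rw [finsum_eq_sum_of_fintype, Finset.sum_eq_single j₁]
    · simp [f]
    · intro j _ hj
      refine CondModel.gain_of_eq_zero (hM.1 j) ?_
      simp [f, hj]
    · simp
  have hmem : ∀ t, t ∈ (M j₀).O ∨ t ∈ (M j₀).I ↔ t ∈ (M j₁).O ∨ t ∈ (M j₁).I := fun t =>
    Set.ext_iff.1 hO t
  -- On the conditioning event of `M j₀`, both gains are those of `h`.
  have e1 : (M j₁).gain f₁ ω = f₀ z₀ ((M j₀).O.domRestrict ω) := by
    have hz : Set.domRestrict₂ hI ((M j₁).I.domRestrict ω) = z₀ := hωz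
    have e2 : (M j₁).I.domRestrict (patch ω₀ ((M j₀).O.domRestrict ω)) =
        (M j₁).I.domRestrict ω := by
      funext ⟨t, ht⟩
      change patch ω₀ ((M j₀).O.domRestrict ω) t = ω t
      by_cases hO' : t ∈ (M j₀).O
      · exact patch_domRestrict_apply _ _ hO'
      · rw [patch_of_notMem _ _ hO', hωz' t (((hmem t).2 (Or.inr ht)).resolve_left hO')]
    have e3 : ∀ y : Assign X (M j₁).O, patch (patch ω₀ ((M j₁).I.domRestrict ω)) y =
        patch (patch ω₀ ((M j₀).O.domRestrict ω)) y := by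
      intro y
      funext t
      by_cases hO1 : t ∈ (M j₁).O
      · rw [patch_of_mem _ _ hO1, patch_of_mem _ _ hO1]
      · rw [patch_of_notMem _ _ hO1, patch_of_notMem _ _ hO1]
        by_cases hI1 : t ∈ (M j₁).I
        · rw [patch_domRestrict_apply _ _ hI1]
          exact (congrFun e2 ⟨t, hI1⟩).symm
        · have hn : ¬ (t ∈ (M j₀).O ∨ t ∈ (M j₀).I) := fun h => by
            rcases (hmem t).1 h with h | h
            exacts [hO1 h, hI1 h]
          rw [patch_of_notMem _ _ hI1, patch_of_notMem _ _ fun h => hn (Or.inl h)]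
    have e4 : patch (patch ω₀ ((M j₀).O.domRestrict ω)) ((M j₁).O.domRestrict ω) =
        patch ω₀ ((M j₀).O.domRestrict ω) := by
      funext t
      by_cases hO1 : t ∈ (M j₁).O
      · rw [patch_domRestrict_apply _ _ hO1]
        by_cases hO' : t ∈ (M j₀).O
        · exact (patch_domRestrict_apply _ _ hO').symm
        · rw [patch_of_notMem _ _ hO', hωz' t (((hmem t).2 (Or.inl hO1)).resolve_left hO')]
      · rw [patch_of_notMem _ _ hO1]
    simp only [CondModel.gain, f₁, f₀, if_pos hz, Pi.sub_apply, lift, e2, e3, e4]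
  rw [hsum, CondModel.gainAt, Set.indicator_of_mem hωz] at hle
  simp only [CondModel.gain] at hle
  have hω' : (M j₀).I.domRestrict ω = z₀ := hωz
  rw [hω', show _ - _ = _ from e1] at hle
  have : 0 ≤ (M j₀).low z₀ (f₀ z₀) := by linarith
  exact this

end JointCoherence

/-! ### Sets of nodes -/

section TreeSets

variable {T : RootedTree.{u}}

theorem after_union (S S' : Set T) : after (S ∪ S') = after S ∪ after S' := by
  ext t
  simp only [after, Set.mem_union, Set.mem_ofPred_eq, or_and_right, exists_or]

theorem mem_after_singleton {s t : T} : t ∈ after {s} ↔ s ≤ t := by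
  simp [after]

theorem notMem_after_of_subset_children {s : T} {S : Set T} (hS : S ⊆ children s) :
    s ∉ after S := by
  rintro ⟨c, hc, hcs⟩
  exact (hS hc).lt.not_ge hcs

theorem after_singleton_eq [Finite T] (s : T) : after {s} = {s} ∪ after (children s) := by
  ext t
  constructor
  · intro ht
    by_cases h : t = s
    · exact Or.inl h
    · exact Or.inr (after_children ht h)
  · rintro (rfl | ⟨c, hc, hct⟩)
    · exact subset_after _ rfl
    · exact mem_after_singleton.2 (hc.le.trans hct)

theorem disjoint_after {s c c' : T} (hc : c ∈ children s) (hc' : c' ∈ children s) (hne : c ≠ c') :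
    Disjoint (after {c}) (after {c'}) := by
  refine Set.disjoint_left.2 fun t ht ht' => ?_
  rcases le_total_of_directed (mem_after_singleton.1 ht) (mem_after_singleton.1 ht') with h | h
  · exact hc.2 hc'.lt (lt_of_le_of_ne h hne.symm)
  · exact hc'.2 hc.lt (lt_of_le_of_ne h hne)

theorem after_subset_or_disjoint {s c : T} (hc : c ∈ children s) {S : Set T}
    (hS : S ⊆ children s) : after {c} ⊆ after S ∨ Disjoint (after {c}) (after S) := by
  by_cases h : c ∈ S
  · exact Or.inl (after_mono (Set.singleton_subset_iff.2 h))
  · refine Or.inr (Set.disjoint_right.2 ?_)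
    rintro t ⟨c', hc', hct⟩
    exact Set.disjoint_right.1 (disjoint_after hc (hS hc') fun e => h (e ▸ hc'))
      (mem_after_singleton.2 hct)

theorem disjoint_of_subset_nonParNonDesc {S R : Set T} (hR : R ⊆ nonParNonDesc S) :
    Disjoint R (after S) := by
  refine Set.disjoint_left.2 ?_
  rintro t ht ⟨c, hc, hct⟩
  exact Set.mem_iInter₂.1 (hR ht) c hc (Or.inr (mem_after_singleton.2 hct))

theorem mother_subset_nonParNonDesc (c : T) : mother c ⊆ nonParNonDesc (children c) := by
  intro t ht
  refine Set.mem_iInter₂.2 ?_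
  rintro d hd (h | h)
  · obtain rfl : t = c := mother_subset hd h
    exact lt_irrefl _ ht.lt
  · exact ((mem_after_singleton.1 h).trans_lt ht.lt).not_ge hd.le

end TreeSets

/-! ### Contingent gambles -/

section Contingent

variable {T : Type u} {X : T → Type v}

/-- A gamble that vanishes unless the variables in `I` take the values in `z`, and that depends
otherwise only on the variables in `O`. -/
structure IsContingent (F : Gamble (∀ t, X t)) (I O : Set T) (z : ∀ t, X t) : Prop where
  zero : ∀ ω : ∀ t, X t, (∃ t ∈ I, ω t ≠ z t) → F ω = 0
  dependsOn : DependsOn F (I ∪ O)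

theorem IsContingent.mono {F : Gamble (∀ t, X t)} {I O O' : Set T} {z : ∀ t, X t}
    (h : IsContingent F I O z) (hO : O ⊆ O') : IsContingent F I O' z :=
  ⟨h.zero, h.dependsOn.mono (Set.union_subset_union_right _ hO)⟩

open Classical in
/-- The indicator of the event that the variables in `A` take the values in `z`. -/
noncomputable def agree (A : Set T) (z : ∀ t, X t) : Gamble (∀ t, X t) :=
  fun ω => if ∀ t ∈ A, ω t = z t then 1 else 0

theorem agree_nonneg (A : Set T) (z : ∀ t, X t) : 0 ≤ agree A z := fun ω => by
  unfold agree
  split_ifs <;> simp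

theorem agree_dependsOn (A : Set T) (z : ∀ t, X t) : DependsOn (agree A z) A := by
  classical
  intro ω ω' h
  exact if_congr (forall₂_congr fun t ht => by rw [h t ht]) rfl rfl

/-- With the variables outside `D ⊇ O` fixed, a contingent gamble is the product of an indicator
about variables in `I` and a gamble on `X_O`. -/
theorem IsContingent.patch_eq_mul {F : Gamble (∀ t, X t)} {I O D : Set T} {z : ∀ t, X t}
    (hF : IsContingent F I O z) (hO : O ⊆ D) {ω : ∀ t, X t}
    (hω : ∀ t ∈ I, t ∉ D → ω t = z t) :
    (fun ω' => F (patch ω (D.domRestrict ω'))) =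
      agree (I ∩ D) z * fun ω' => F (patch z (O.domRestrict ω')) := by
  funext ω'
  by_cases h : ∀ t ∈ I ∩ D, ω' t = z t
  · have h1 : agree (I ∩ D) z ω' = 1 := if_pos h
    rw [Pi.mul_apply, h1, one_mul]
    refine hF.dependsOn fun t ht => ?_
    by_cases hO' : t ∈ O
    · rw [patch_domRestrict_apply _ _ hO', patch_domRestrict_apply _ _ (hO hO')]
    · rw [patch_of_notMem _ _ hO']
      by_cases hD : t ∈ D
      · rw [patch_domRestrict_apply _ _ hD, h t ⟨ht.resolve_right hO', hD⟩]
      · rw [patch_of_notMem _ _ hD, hω t (ht.resolve_right hO') hD]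
  · have h1 : agree (I ∩ D) z ω' = 0 := if_neg h
    rw [Pi.mul_apply, h1, zero_mul]
    push Not at h
    obtain ⟨t, ht, hne⟩ := h
    exact hF.zero _ ⟨t, ht.1, by rwa [patch_domRestrict_apply _ _ ht.2]⟩

/-- The gains on a conditioning event, lowered by `ε` on that event, are contingent on it. -/
theorem isContingent_gainAt (M : CondModel X) (f : M.Dom) (ε : ℝ) (z : ∀ t, X t) :
    IsContingent (M.gainAt f (M.I.domRestrict z) -
      (cyl (M.I.domRestrict z)).indicator (fun _ => ε)) M.I M.O z where
  zero ω hω := by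
    have h : ω ∉ cyl (M.I.domRestrict z) := fun h => by
      obtain ⟨t, ht, hne⟩ := hω
      exact hne (congrFun h ⟨t, ht⟩)
    rw [Pi.sub_apply, CondModel.gainAt, Set.indicator_of_notMem h, Set.indicator_of_notMem h,
      sub_zero]
  dependsOn ω ω' h := by
    have hI : M.I.domRestrict ω = M.I.domRestrict ω' := funext fun t => h t (Or.inl t.2)
    have hO : M.O.domRestrict ω = M.O.domRestrict ω' := funext fun t => h t (Or.inr t.2)
    have hc : ω ∈ cyl (M.I.domRestrict z) ↔ ω' ∈ cyl (M.I.domRestrict z) := by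
      simp only [cyl, Set.mem_ofPred_eq, hI]
    classical
    simp only [Pi.sub_apply, CondModel.gainAt, Set.indicator_apply, hc, CondModel.gain, hI, hO]

end Contingent

/-! ### The conditionally independent natural extension in a node -/

section Node

theorem IsCoherent.map {Y Z : Type*} [Finite Z] [Nonempty Y] {P : Gamble Y → ℝ}
    (hP : IsCoherent P) (φ : Y → Z) : IsCoherent (fun g : Gamble Z => P (fun y => g (φ y))) where
  min_le g := (le_ciInf fun y => ciInf_le (Set.finite_range g).bddBelow (φ y)).trans (hP.min_le _)
  superadd _ _ := hP.superadd _ _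
  nonneg_hom c _ hc := hP.nonneg_hom c _ hc

variable {T : RootedTree.{u}} {X : T → Type v} {s : T}

/-- The models of the children of `s`, conditional on the value `x` of `X_s`. -/
def blocksAt (P : ∀ c ∈ children s, CondLP X (after {c}) {s}) (x : Assign X {s}) :
    ∀ k : children s, Gamble (Assign X (after {(k : T)})) → ℝ :=
  fun k => P k k.2 x

/-- An explicit form of the conditionally independent natural extension: conditional on `X_s`, the
independent natural extension of the models of the children of `s`. -/
noncomputable def childExt (P : ∀ c ∈ children s, CondLP X (after {c}) {s}) :
    CondLP X (after (children s)) {s} :=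
  fun x f => natExt (blocksAt P x) (fun ω => f ((after (children s)).domRestrict ω))

/-- The restriction of `E` to the gambles on `X_{↓S}`, conditional on the larger set `I` of
variables: a model for which the variables in `I` other than `X_s` are irrelevant. -/
def branchModel (E : CondLP X (after (children s)) {s}) {S : Set T} (hS : S ⊆ children s)
    {I : Set T} (hs : {s} ⊆ I) : CondModel X where
  O := after S
  I := I
  low := fun z g => E (Set.domRestrict₂ hs z) (fun y => g (Set.domRestrict₂ (after_mono hS) y))

theorem lift_childExt (P : ∀ c ∈ children s, CondLP X (after {c}) {s})
    (F : Gamble (∀ t, X t)) (ω : ∀ t, X t) :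
    lift (childExt P) F ω = natExt (blocksAt P (Set.domRestrict {s} ω))
      (fun ω' => F (patch ω ((after (children s)).domRestrict ω'))) := rfl

theorem domRestrict_eq_of_agree {I : Set T} (hs : {s} ⊆ I) {z ω : ∀ t, X t}
    (hω : ∀ t ∈ I, t ∉ after (children s) → ω t = z t) :
    Set.domRestrict {s} ω = Set.domRestrict {s} z := by
  funext ⟨t, ht⟩
  obtain rfl : t = s := ht
  exact hω t (hs rfl) (notMem_after_of_subset_children subset_rfl)

variable [Finite T] [∀ t, Finite (X t)] [∀ t, Nonempty (X t)]
  {P : ∀ c ∈ children s, CondLP X (after {c}) {s}}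

theorem childExt_coherent (hP : ∀ x, GoodBlocks (blocksAt P x)) : SepCoherent (childExt P) :=
  fun x => (hP x).isCoherent_natExt.map _

theorem branchModel_coherent {E : CondLP X (after (children s)) {s}} (hE : SepCoherent E)
    {S : Set T} (hS : S ⊆ children s) {I : Set T} (hs : {s} ⊆ I) :
    SepCoherent (branchModel E hS hs).low :=
  fun _ => (hE _).map _

theorem childExt_extends (hP : ∀ x, GoodBlocks (blocksAt P x)) {c : T} (hc : c ∈ children s)
    (x : Assign X {s}) (g : Gamble (Assign X (after {c}))) :
    childExt P x (fun y => g (Set.domRestrict₂ (after_mono (Set.singleton_subset_iff.2 hc)) y)) =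
      P c hc x g := by
  refine ((hP x).natExt_eq ⟨c, hc⟩ (f := fun ω => g ((after {c}).domRestrict ω)) ?_
    (Classical.arbitrary _)).trans ?_
  · intro ω ω' h
    exact congrArg g (funext fun t => h t t.2)
  · simp only [domRestrict_patch]
    rfl

section Contingent

variable {F : Gamble (∀ t, X t)} {I S : Set T} {z : ∀ t, X t}

theorem lift_childExt_eq_zero (hP : ∀ x, GoodBlocks (blocksAt P x)) {O : Set T}
    (hF : IsContingent F I O z)
    {ω : ∀ t, X t} (hω : ∃ t ∈ I, t ∉ after (children s) ∧ ω t ≠ z t) :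
    lift (childExt P) F ω = 0 := by
  obtain ⟨t, ht, htD, hne⟩ := hω
  rw [lift_childExt]
  refine Eq.trans (congrArg _ (funext fun ω' => ?_)) (hP _).isCoherent_natExt.zero
  refine hF.zero _ ⟨t, ht, ?_⟩
  rwa [patch_of_notMem _ _ htD]

theorem lift_childExt_nonneg (hP : ∀ x, GoodBlocks (blocksAt P x)) (hS : S ⊆ children s)
    (hF : IsContingent F I (after S) z) (hI : Disjoint I (after S)) {ω : ∀ t, X t}
    (hω : ∀ t ∈ I, t ∉ after (children s) → ω t = z t)
    (h0 : 0 ≤ natExt (blocksAt P (Set.domRestrict {s} ω))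
      (fun ω' => F (patch z ((after S).domRestrict ω')))) :
    0 ≤ lift (childExt P) F ω := by
  rw [lift_childExt, hF.patch_eq_mul (after_mono hS) hω]
  refine (hP _).natExt_mul_nonneg (fun k => after_subset_or_disjoint k.2 hS) ?_
    ((agree_dependsOn _ _).mono fun t ht => Set.disjoint_left.1 hI ht.1) (agree_nonneg _ _) h0
  exact fun ω₁ ω₂ h => congrArg F (congrArg _ (funext fun t => h t t.2))

theorem lift_childExt_neg (hP : ∀ x, GoodBlocks (blocksAt P x)) (hS : S ⊆ children s)
    (hF : IsContingent F I (after S) z) (hI : Disjoint I (after S)) {ω : ∀ t, X t}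
    (hω : ∀ t ∈ I, t ∉ after (children s) → ω t = z t)
    (h0 : natExt (blocksAt P (Set.domRestrict {s} ω))
      (fun ω' => F (patch z ((after S).domRestrict ω'))) < 0) :
    lift (childExt P) F ω < 0 := by
  rw [lift_childExt, hF.patch_eq_mul (after_mono hS) hω]
  refine (hP _).natExt_mul_neg (fun k => after_subset_or_disjoint k.2 hS) ?_
    ((agree_dependsOn _ _).mono fun t ht => Set.disjoint_left.1 hI ht.1) (agree_nonneg _ _)
    (ω := z) (by simp [agree]) h0
  exact fun ω₁ ω₂ h => congrArg F (congrArg _ (funext fun t => h t t.2))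

end Contingent

section Regular

variable {S I : Set T}

/-- Given the conditioning event, the gain of `f` lowered by `ε` has lower prevision `-ε`. -/
theorem natExt_gainAt (hP : ∀ x, GoodBlocks (blocksAt P x)) (hS : S ⊆ children s)
    (hs : {s} ⊆ I) (hI : Disjoint I (after S)) (f : (branchModel (childExt P) hS hs).Dom) (ε : ℝ)
    (z : ∀ t, X t) :
    natExt (blocksAt P (Set.domRestrict {s} z)) (fun ω' =>
      ((branchModel (childExt P) hS hs).gainAt f (I.domRestrict z) -
      (cyl (I.domRestrict z)).indicator (fun _ => ε)) (patch z ((after S).domRestrict ω'))) =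
      -ε := by
  set V := natExt (blocksAt P (Set.domRestrict {s} z))
    (fun ω' => f (I.domRestrict z) ((after S).domRestrict ω')) with hV
  have e : ∀ ω' : ∀ t, X t, ((branchModel (childExt P) hS hs).gainAt f (I.domRestrict z) -
      (cyl (I.domRestrict z)).indicator (fun _ => ε)) (patch z ((after S).domRestrict ω')) =
      f (I.domRestrict z) ((after S).domRestrict ω') - (V + ε) := by
    intro ω'
    have h1 : I.domRestrict (patch z ((after S).domRestrict ω')) = I.domRestrict z :=
      domRestrict_patch_of_disjoint hI.symm _ _
    have h2 : patch z ((after S).domRestrict ω') ∈ cyl (I.domRestrict z) := h1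
    have h3 : (after S).domRestrict (patch z ((after S).domRestrict ω')) =
      (after S).domRestrict ω' := domRestrict_patch _ _
    have h4 : (branchModel (childExt P) hS hs).gain f (patch z ((after S).domRestrict ω')) =
        f (I.domRestrict z) ((after S).domRestrict ω') - V := by
      simp only [CondModel.gain, branchModel, h1, h3]
      rfl
    change (cyl (I.domRestrict z)).indicator ((branchModel (childExt P) hS hs).gain f) _ -
      (cyl (I.domRestrict z)).indicator _ _ = _
    rw [Set.indicator_of_mem h2, Set.indicator_of_mem h2, h4]
    ring
  simp only [e]
  rw [(hP _).isCoherent_natExt.sub_const, ← hV]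
  ring

/-- Conditional on `X_s`, the conditionally independent natural extension accepts the gains of the
models that it induces. -/
theorem lift_childExt_gainAt_nonneg (hP : ∀ x, GoodBlocks (blocksAt P x)) (hS : S ⊆ children s)
    (hs : {s} ⊆ I) (hI : Disjoint I (after S)) (f : (branchModel (childExt P) hS hs).Dom)
    (z : Assign X I) (ω : ∀ t, X t) :
    0 ≤ lift (childExt P) ((branchModel (childExt P) hS hs).gainAt f z) ω := by
  obtain ⟨z, rfl⟩ : ∃ z' : ∀ t, X t, I.domRestrict z' = z :=
    ⟨patch (Classical.arbitrary _) z, domRestrict_patch _ _⟩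
  have hF := isContingent_gainAt (branchModel (childExt P) hS hs) f 0 z
  have h0 := natExt_gainAt hP hS hs hI f 0 z
  have e : (cyl ((branchModel (childExt P) hS hs).I.domRestrict z)).indicator
      (fun _ => (0 : ℝ)) = 0 := Set.indicator_zero _ _
  have e' : (cyl (I.domRestrict z)).indicator (fun _ => (0 : ℝ)) = 0 := Set.indicator_zero _ _
  rw [e, sub_zero] at hF
  rw [e', sub_zero] at h0
  by_cases hω : ∀ t ∈ I, t ∉ after (children s) → ω t = z t
  · refine lift_childExt_nonneg hP hS hF hI hω ?_
    rw [domRestrict_eq_of_agree hs hω]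
    exact (h0.trans neg_zero).ge
  · push Not at hω
    exact (lift_childExt_eq_zero hP hF hω).ge

/-- Conditional on `X_s`, the conditionally independent natural extension rejects the gains of the
models that it induces once they are lowered by a positive amount. -/
theorem lift_childExt_gainAt_sub_neg (hP : ∀ x, GoodBlocks (blocksAt P x)) (hS : S ⊆ children s)
    (hs : {s} ⊆ I) (hI : Disjoint I (after S)) (f : (branchModel (childExt P) hS hs).Dom)
    {ε : ℝ} (hε : 0 < ε) {z ω : ∀ t, X t}
    (hω : ∀ t ∈ I, t ∉ after (children s) → ω t = z t) :
    lift (childExt P) ((branchModel (childExt P) hS hs).gainAt f (I.domRestrict z) -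
      (cyl (I.domRestrict z)).indicator (fun _ => ε)) ω < 0 := by
  have hF := isContingent_gainAt (branchModel (childExt P) hS hs) f ε z
  refine lift_childExt_neg hP hS hF hI hω ?_
  rw [domRestrict_eq_of_agree hs hω]
  exact (natExt_gainAt hP hS hs hI f ε z).trans_lt (neg_lt_zero.2 hε)

end Regular

/-- The lower envelope of a conditional lower prevision over all values of the variables. -/
theorem isCoherent_iInf_lift {O I : Set T} {V : CondLP X O I}
    (hV : SepCoherent V) : IsCoherent (fun F => ⨅ ω, lift V F ω) := by
  have hb : ∀ F, BddBelow (Set.range (lift V F)) := fun F => (Set.finite_range _).bddBelow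
  refine ⟨fun F => le_ciInf fun ω => ?_, fun F G => le_ciInf fun ω => ?_, fun c F hc => ?_⟩
  · exact ((hV _).map (fun w => patch ω w)).min_le F
  · exact (add_le_add (ciInf_le (hb F) ω) (ciInf_le (hb G) ω)).trans
      (((hV _).map (fun w => patch ω w)).superadd F G)
  · rw [Real.mul_iInf_of_nonneg hc]
    exact iInf_congr fun ω => ((hV _).map (fun w => patch ω w)).nonneg_hom c F hc

/-- The explicit form is a conditionally independent product: the models that it induces are the
regular extensions of its lower envelope over the values of the other variables. -/
theorem childExt_isCondIndProduct (hP : ∀ x, GoodBlocks (blocksAt P x)) :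
    IsCondIndProduct s P (childExt P) := by
  refine ⟨fun c hc x g => childExt_extends hP hc x g, ?_⟩
  have hE := childExt_coherent hP
  have hreg : ∀ {S I : Set T} (hS : S ⊆ children s) (hs : {s} ⊆ I) (hI : Disjoint I (after S)),
      IsRegular (fun F => ⨅ ω, lift (childExt P) F ω) (branchModel (childExt P) hS hs) := by
    intro S I hS hs hI f z
    refine ⟨le_ciInf fun ω => lift_childExt_gainAt_nonneg hP hS hs hI f z ω, fun ε hε => ?_⟩
    obtain ⟨z, rfl⟩ : ∃ z' : ∀ t, X t, I.domRestrict z' = z :=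
      ⟨patch (Classical.arbitrary _) z, domRestrict_patch _ _⟩
    exact (ciInf_le (Set.finite_range _).bddBelow z).trans_lt
      (lift_childExt_gainAt_sub_neg hP hS hs hI f hε fun _ _ _ => rfl)
  have hsD : Disjoint {s} (after (children s)) :=
    Set.disjoint_singleton_left.2 (notMem_after_of_subset_children subset_rfl)
  refine jointlyCoherent_of_isRegular (isCoherent_iInf_lift hE) ?_ ?_
  · rintro (_ | b)
    · exact hE
    · exact branchModel_coherent hE b.ssubset_O.subset Set.subset_union_left
  · rintro (_ | b)
    · exact hreg subset_rfl subset_rfl hsD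
    · refine hreg b.ssubset_O.subset Set.subset_union_left (Set.disjoint_union_left.2 ⟨?_, ?_⟩)
      · exact hsD.mono_right (after_mono b.ssubset_O.subset)
      · refine Set.disjoint_left.2 ?_
        rintro t ⟨c, hc, hct⟩ ⟨c', hc', hct'⟩
        exact Set.disjoint_left.1 (disjoint_after (b.ssubset_I.subset hc) (b.ssubset_O.subset hc')
          fun e => Set.disjoint_left.1 b.disjoint hc' (e ▸ hc)) (mem_after_singleton.2 hct)
          (mem_after_singleton.2 hct')

/-- The explicit form is dominated by each conditionally independent product: when there is more
than one child, joint coherence with the model of one child conditional on all of the others makes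
the product accept that model's gains; with one child the extension property suffices. -/
theorem childExt_le (hP : ∀ x, GoodBlocks (blocksAt P x)) {R : CondLP X (after (children s)) {s}}
    (hR : IsCondIndProduct s P R) : childExt P ≤ R := by
  intro x f
  have hRc : SepCoherent R := hR.2.1 none
  have hsD : Disjoint (after (children s)) {s} :=
    Set.disjoint_singleton_right.2 (notMem_after_of_subset_children subset_rfl)
  obtain ⟨ω, rfl⟩ : ∃ ω : ∀ t, X t, Set.domRestrict {s} ω = x :=
    ⟨patch (Classical.arbitrary _) x, domRestrict_patch _ _⟩
  have key := (hP (Set.domRestrict {s} ω)).natExt_le_of_accepts (A := after (children s))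
    (fun k => Or.inl (after_mono (Set.singleton_subset_iff.2 k.2))) (hRc (Set.domRestrict {s} ω)) ω
    (f := fun ω => f ((after (children s)).domRestrict ω)) ?_
    (fun ω ω' h => congrArg f (funext fun t => h t t.2))
  · simp only [domRestrict_patch] at key
    exact key
  · rintro ⟨k, hk⟩ - F
    by_cases hone : ∃ c ∈ children s, c ≠ k
    · obtain ⟨c, hc, hck⟩ := hone
      let b : BlockPair s := {
        O := {k}
        I := children s \ {k}
        nonempty := Set.singleton_nonempty k
        disjoint := Set.disjoint_sdiff_right
        ssubset_O := ⟨Set.singleton_subset_iff.2 hk, fun h => hck (h hc)⟩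
        ssubset_I := ⟨Set.sdiff_subset, fun h => (h hk).2 rfl⟩ }
      have h := hR.2.lift_sub_nonneg none (some b) Set.subset_union_left ?_ F ω
      · refine h.trans_eq (congrArg (R (Set.domRestrict {s} ω))
          (funext fun (w : Assign X (after (children s))) => ?_))
        rw [Pi.sub_apply]
        refine congrArg (F (patch ω w) - ·) ?_
        refine (hR.1 k hk (Set.domRestrict {s} (patch ω w))
          (fun v => F (patch (patch ω w) v))).trans ?_
        rw [domRestrict_patch_of_disjoint hsD ω w]
        rfl
      · change after (children s) ∪ {s} = after {k} ∪ ({s} ∪ after (children s \ {k}))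
        rw [Set.union_left_comm, ← after_union, Set.union_sdiff_cancel
          (Set.singleton_subset_iff.2 hk), Set.union_comm]
    · have hk1 : children s ⊆ {k} := fun c hc => by
        by_contra hne
        exact hone ⟨c, hc, hne⟩
      have hsub : after (children s) ⊆ after {k} := after_mono hk1
      have e1 : ∀ w : Assign X (after (children s)), ∀ v : Assign X (after {k}),
          patch (patch ω w) v = patch ω v := by
        intro w v
        funext t
        by_cases ht : t ∈ after {k}
        · rw [patch_of_mem _ _ ht, patch_of_mem _ _ ht]
        · rw [patch_of_notMem _ _ ht, patch_of_notMem _ _ ht,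
            patch_of_notMem _ _ fun h => ht (hsub h)]
      have e2 : ∀ w : Assign X (after (children s)), patch ω w =
          patch ω (Set.domRestrict₂ (after_mono (Set.singleton_subset_iff.2 hk)) w) := by
        intro w
        funext t
        by_cases ht : t ∈ after (children s)
        · rw [patch_of_mem _ _ ht, patch_of_mem _ _ (hsub ht)]
          rfl
        · rw [patch_of_notMem _ _ ht, patch_of_notMem _ _ fun h =>
            ht (after_mono (Set.singleton_subset_iff.2 hk) h)]
      have e3 := hR.1 k hk (Set.domRestrict {s} ω) (fun v => F (patch ω v))
      simp only [← e2] at e3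
      simp only [blockLift, e1]
      rw [(hRc _).sub_const, e3]
      exact (sub_self _).ge

theorem isLeast_childExt (hP : ∀ x, GoodBlocks (blocksAt P x)) :
    IsLeast {R | IsCondIndProduct s P R} (childExt P) :=
  ⟨childExt_isCondIndProduct hP, fun _ hR => childExt_le hP hR⟩

theorem condIndNatExt_eq (hP : ∀ x, GoodBlocks (blocksAt P x)) :
    condIndNatExt s P = childExt P := by
  funext x f
  refine IsLeast.csInf_eq ⟨⟨_, childExt_isCondIndProduct hP, rfl⟩, ?_⟩
  rintro _ ⟨R, hR, rfl⟩
  exact childExt_le hP hR x f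

end Node

/-! ### The recursion from the leaves to the root -/

section Recursion

/-- The marginal extension of coherent lower previsions is coherent. -/
theorem IsCoherent.marginalExt {A W Y : Type*} [Finite Y] [Nonempty A] [Nonempty W]
    {P : Gamble A → ℝ} (hP : IsCoherent P) {E : A → Gamble W → ℝ} (hE : ∀ a, IsCoherent (E a))
    (φ : A → W → Y) : IsCoherent (fun g : Gamble Y => P (fun a => E a (fun w => g (φ a w)))) where
  min_le g := by
    refine (hP.const _).ge.trans (hP.mono fun a => ?_)
    exact ((hE a).map (φ a)).min_le g
  superadd f g := (hP.superadd _ _).trans (hP.mono fun a => (hE a).superadd _ _)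
  nonneg_hom c f hc := by
    rw [← hP.nonneg_hom _ _ hc]
    exact congrArg P (funext fun a => (hE a).nonneg_hom c _ hc)

variable {T : RootedTree.{u}} [Finite T] {X : T → Type v}

/-- The global models of the children of `s`, conditional on `X_s`. -/
noncomputable def subModels (Q : LocalModels X) (s : T) :
    ∀ c ∈ children s, CondLP X (after {c}) {s} :=
  fun c hc z => subtreeModel Q c (Set.domRestrict₂ (mother_subset hc) z)

theorem glue_self {s : T} (y : Assign X (after {s})) :
    glue (fun t : ({s} : Set T) => y ⟨t, subset_after _ t.2⟩)
      (fun t : after (children s) => y ⟨t, (after_singleton_eq s).ge (Or.inr t.2)⟩) = y := by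
  funext t
  unfold glue
  split_ifs with h <;> rfl

variable [∀ t, Nonempty (X t)] {Q : LocalModels X}

/-- The recursion holds in each node, with a trivial natural extension in the leaves. -/
theorem subtreeModel_apply {s : T} (h : SepCoherent (childrenModel Q s))
    (x : Assign X (mother s)) (g : Gamble (Assign X (after {s}))) :
    subtreeModel Q s x g = Q s x (fun a => childrenModel Q s a (fun w => g (glue a w))) := by
  rw [subtreeModel]
  split_ifs with hc
  · rfl
  · refine congrArg (Q s x) (funext fun a => ?_)
    have e : ∀ w : Assign X (after (children s)),
        glue a w = Set.domRestrict₂ (after_leaf hc) a := by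
      intro w
      funext t
      exact dif_pos (after_leaf hc t.2)
    simp only [e]
    exact ((h a).const _).symm

variable [∀ t, Finite (X t)]

/-- Coherence and strict positivity of the conjugate pass from the children to their mother, so that
the independent natural extensions are well behaved throughout the recursion. -/
theorem subtreeModel_coherent_and_pos (hQ : ∀ s, SepCoherent (Q s))
    (hpos : ∀ (s : T) (x : Assign X (mother s)), StrictlyPositive (upper (Q s x))) (s : T) :
    ∀ x, IsCoherent (subtreeModel Q s x) ∧ StrictlyPositive (upper (subtreeModel Q s x)) := by
  induction s using WellFoundedGT.induction with
  | ind s ih =>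
    have hgood : ∀ x, GoodBlocks (blocksAt (subModels Q s) x) := fun x => {
      disjoint := fun k l hkl => disjoint_after k.2 l.2 fun e => hkl (Subtype.ext e)
      coherent := fun k => (ih k k.2.lt _).1
      pos := fun k => (ih k k.2.lt _).2 }
    have he : childrenModel Q s = childExt (subModels Q s) := condIndNatExt_eq hgood
    have hE : SepCoherent (childrenModel Q s) := he ▸ childExt_coherent hgood
    intro x
    have e : subtreeModel Q s x = _ := funext fun g => subtreeModel_apply hE x g
    refine ⟨e ▸ (hQ s x).marginalExt hE _, fun y => ?_⟩
    rw [e, upper, neg_pos]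
    set a₀ : Assign X {s} := fun t => y ⟨t, subset_after _ t.2⟩
    refine (hQ s x).neg_of_strictlyPositive (hpos s x) (fun a => ?_) (y := a₀) ?_
    · rw [Pi.zero_apply, ← (hE a).zero]
      exact (hE a).mono fun w => neg_nonpos.2 (Set.indicator_nonneg (fun _ _ => zero_le_one) _)
    · rw [he]
      refine (hgood a₀).natExt_neg (fun ω => neg_nonpos.2
        (Set.indicator_nonneg (fun _ _ => zero_le_one) _))
        (ω := patch (Classical.arbitrary _) y) ?_
      have : glue a₀ ((after (children s)).domRestrict
          (patch (Classical.arbitrary (∀ t, X t)) y)) = y := by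
        refine Eq.trans (congrArg _ ?_) (glue_self y)
        funext t
        exact patch_of_mem _ _ ((after_singleton_eq s).ge (Or.inr t.2))
      simp [this]

theorem goodBlocks_subModels (hQ : ∀ s, SepCoherent (Q s))
    (hpos : ∀ (s : T) (x : Assign X (mother s)), StrictlyPositive (upper (Q s x)))
    (s : T) (x : Assign X {s}) :
    GoodBlocks (blocksAt (subModels Q s) x) where
  disjoint k l hkl := disjoint_after k.2 l.2 fun e => hkl (Subtype.ext e)
  coherent k := (subtreeModel_coherent_and_pos hQ hpos k _).1
  pos k := (subtreeModel_coherent_and_pos hQ hpos k _).2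

theorem childrenModel_eq (hQ : ∀ s, SepCoherent (Q s))
    (hpos : ∀ (s : T) (x : Assign X (mother s)), StrictlyPositive (upper (Q s x)))
    (s : T) : childrenModel Q s = childExt (subModels Q s) :=
  condIndNatExt_eq (goodBlocks_subModels hQ hpos s)

theorem childrenModel_coherent (hQ : ∀ s, SepCoherent (Q s))
    (hpos : ∀ (s : T) (x : Assign X (mother s)), StrictlyPositive (upper (Q s x)))
    (s : T) : SepCoherent (childrenModel Q s) :=
  childrenModel_eq hQ hpos s ▸ childExt_coherent (goodBlocks_subModels hQ hpos s)

/-- The recursion, as an identity between operators on the gambles on the joint possibility space. -/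
theorem lift_subtreeModel (hQ : ∀ s, SepCoherent (Q s))
    (hpos : ∀ (s : T) (x : Assign X (mother s)), StrictlyPositive (upper (Q s x)))
    (s : T) (F : Gamble (∀ t, X t)) (ω : ∀ t, X t) :
    lift (subtreeModel Q s) F ω = Q s ((mother s).domRestrict ω)
      (fun a => lift (childrenModel Q s) F (patch ω a)) := by
  refine (subtreeModel_apply (childrenModel_coherent hQ hpos s) _ _).trans ?_
  refine congrArg _ (funext fun a => ?_)
  refine Eq.trans (congrArg (childrenModel Q s a) (funext fun w => congrArg F ?_))
    (congrArg (fun a => childrenModel Q s a _) (domRestrict_patch ω a).symm)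
  funext t
  by_cases ht : t ∈ after {s}
  · rw [patch_of_mem _ _ ht]
    unfold glue
    split_ifs with h
    · have hts : t = s := h
      have ht' : t ∉ after (children s) := hts ▸ notMem_after_of_subset_children subset_rfl
      rw [patch_of_notMem _ _ ht']
      exact (patch_of_mem (O := {s}) _ _ h).symm
    · exact (patch_of_mem _ _ (after_children ht h)).symm
  · rw [after_singleton_eq, Set.mem_union, not_or] at ht
    rw [patch_of_notMem _ _ ht.2, patch_of_notMem _ _ ht.1, patch_of_notMem]
    rw [after_singleton_eq]
    exact fun h => h.elim ht.1 ht.2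

end Recursion

/-! ### The joint lower prevision -/

section Joint

variable {T : RootedTree.{u}} {X : T → Type v} {Q : LocalModels X}

theorem isRegular_jointModel [∀ t, Nonempty (X t)]
    {P : Gamble (∀ t, X t) → ℝ} (hP : IsCoherent P) :
    IsRegular P (jointModel P) := by
  intro f z
  have hc : ∀ ω, ω ∈ cyl z := fun ω => funext fun t => t.2.elim
  have hI : ∀ ω : ∀ t, X t, Set.domRestrict ∅ ω = z := hc
  have e : (jointModel P).gainAt f z =
      fun ω => f z (Set.univ.domRestrict ω) - P (fun ω => f z (Set.univ.domRestrict ω)) := by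
    funext ω
    refine (Set.indicator_of_mem (hc ω) _).trans ?_
    simp only [CondModel.gain, jointModel, hI]
  refine ⟨?_, fun ε hε => ?_⟩
  · rw [e, hP.sub_const, sub_self]
  · have e' : (jointModel P).gainAt f z - (cyl z).indicator (fun _ => ε) = fun ω =>
        f z (Set.univ.domRestrict ω) - (P (fun ω => f z (Set.univ.domRestrict ω)) + ε) := by
      rw [e]
      funext ω
      rw [Pi.sub_apply, Set.indicator_of_mem (hc ω)]
      ring
    rw [e', hP.sub_const]
    linarith

variable [Finite T]

theorem joint_eq_lift (F : Gamble (∀ t, X t)) (ω : ∀ t, X t) :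
    (globalModels Q).joint F = lift (subtreeModel Q (⊥ : T)) F ω := by
  refine Eq.trans (congrArg (subtreeModel Q ⊥ _) (funext fun w => congrArg F (funext fun t => ?_)))
    (congrArg (fun x => subtreeModel Q ⊥ x _) (funext fun t => (not_lt_bot t.2.lt).elim))
  exact (patch_of_mem (O := after {⊥}) ω w ⟨⊥, rfl, bot_le⟩).symm

variable [∀ t, Finite (X t)] [∀ t, Nonempty (X t)]

/-- A gamble that is accepted conditional on every value of a node variable remains accepted on the way from
that node to the root. -/
theorem lift_subtreeModel_nonneg (hQ : ∀ s, SepCoherent (Q s))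
    (hpos : ∀ (s : T) (x : Assign X (mother s)), StrictlyPositive (upper (Q s x)))
    {s : T} {F : Gamble (∀ t, X t)} (hF : ∀ ω, 0 ≤ lift (childrenModel Q s) F ω) (r : T)
    (hr : r ≤ s) : ∀ ω, 0 ≤ lift (subtreeModel Q r) F ω := by
  induction r using WellFoundedGT.induction with
  | ind r ih =>
    suffices h : ∀ ω, 0 ≤ lift (childrenModel Q r) F ω by
      intro ω
      rw [lift_subtreeModel hQ hpos]
      exact (hQ r _).nonneg fun a => h _
    rcases hr.eq_or_lt with rfl | hlt
    · exact hF
    · obtain ⟨c, hc, hcs⟩ := exists_covBy_le_of_lt hlt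
      intro ω
      rw [childrenModel_eq hQ hpos, lift_childExt]
      refine (goodBlocks_subModels hQ hpos r _).le_natExt fun p hp => ?_
      refine (hp.1.nonneg _ fun ω' => ?_).trans (hp.2 ⟨c, hc⟩ trivial _)
      refine (ih c hc.lt hcs (patch ω ((after (children r)).domRestrict ω'))).trans_eq ?_
      simp only [blockLift]
      have hsub : after {c} ⊆ after (children r) := after_mono (Set.singleton_subset_iff.2 hc)
      simp only [← patch_patch_of_subset hsub]
      refine congrArg (fun x => subtreeModel Q c x _) (funext fun t => ?_)
      obtain rfl : (t : T) = r := mother_subset hc t.2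
      exact patch_of_notMem _ _ (notMem_after_of_subset_children subset_rfl)

/-- A gamble contingent on `X_I = z` that is rejected conditional on the node variable, when the
variables in `I` outside the subtree have their values in `z`, remains rejected on the way from that
node to the root. In a node of `I`, only the value in `z` gives a negative contribution, which the
strict positivity of the local upper prevision preserves. -/
theorem lift_subtreeModel_neg (hQ : ∀ s, SepCoherent (Q s))
    (hpos : ∀ (s : T) (x : Assign X (mother s)), StrictlyPositive (upper (Q s x)))
    {s : T} {F : Gamble (∀ t, X t)} {I : Set T} {z : ∀ t, X t}
    (hFI : IsContingent F I (after (children s)) z)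
    (hF : ∀ ω, (∀ t ∈ I, t ∉ after (children s) → ω t = z t) → lift (childrenModel Q s) F ω < 0)
    (r : T) (hr : r ≤ s) :
    ∀ ω, (∀ t ∈ I, t ∉ after {r} → ω t = z t) → lift (subtreeModel Q r) F ω < 0 := by
  induction r using WellFoundedGT.induction with
  | ind r ih =>
    suffices h : ∀ ω, (∀ t ∈ I, t ∉ after (children r) → ω t = z t) →
        lift (childrenModel Q r) F ω < 0 by
      intro ω hω
      rw [lift_subtreeModel hQ hpos]
      refine (hQ r _).neg_of_strictlyPositive (hpos r _) (fun a => ?_)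
        (y := Set.domRestrict {r} z) (h _ fun t ht htD => ?_)
      · by_cases ha : ∀ t ∈ I, t ∉ after (children r) → patch ω a t = z t
        · exact (h _ ha).le
        · push Not at ha
          rw [childrenModel_eq hQ hpos]
          exact (lift_childExt_eq_zero (goodBlocks_subModels hQ hpos r) hFI ha).le
      · by_cases htr : t ∈ ({r} : Set T)
        · exact patch_domRestrict_apply _ _ htr
        · rw [patch_of_notMem _ _ htr]
          refine hω t ht fun h => ?_
          rw [after_singleton_eq] at h
          exact h.elim htr htD
    rcases hr.eq_or_lt with rfl | hlt
    · exact hF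
    · obtain ⟨c, hc, hcs⟩ := exists_covBy_le_of_lt hlt
      intro ω hω
      have hsub : after (children s) ⊆ after {c} := by
        rintro t ⟨d, hd, hdt⟩
        exact mem_after_singleton.2 (hcs.trans (hd.le.trans hdt))
      have hFc : IsContingent F (I \ after {c}) (after {c}) z :=
        ⟨fun ω ⟨t, ht, h⟩ => hFI.zero ω ⟨t, ht.1, h⟩, hFI.dependsOn.mono fun t ht => by
          rw [Set.sdiff_union_self]
          exact ht.imp_right fun h => hsub h⟩
      rw [childrenModel_eq hQ hpos]
      refine lift_childExt_neg (goodBlocks_subModels hQ hpos r) (Set.singleton_subset_iff.2 hc)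
        hFc Set.disjoint_sdiff_left (fun t ht => hω t ht.1) ?_
      rw [(goodBlocks_subModels hQ hpos r _).natExt_eq ⟨c, hc⟩
        (f := fun ω' => F (patch z ((after {c}).domRestrict ω'))) (fun ω ω' h =>
          congrArg (fun w : Assign X (after {c}) => F (patch z w)) (funext fun t => h t t.2)) z]
      simp only [domRestrict_patch]
      -- The value of the variable of `r` enters through the conditioning only.
      refine (le_of_eq ?_).trans_lt (ih c hc.lt hcs (patch z (Set.domRestrict {r} ω)) ?_)
      · refine Eq.trans (congrArg (fun x => subtreeModel Q c x _) ?_)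
          (congrArg (subtreeModel Q c _) (funext fun w => hFI.dependsOn fun t ht => ?_))
        · funext ⟨t, ht⟩
          exact (patch_domRestrict_apply z ω (mother_subset hc ht)).symm
        · by_cases htc : t ∈ after {c}
          · rw [patch_of_mem _ _ htc, patch_of_mem _ _ htc]
          · rw [patch_of_notMem _ _ htc, patch_of_notMem _ _ htc]
            by_cases htr : t ∈ ({r} : Set T)
            · rw [patch_domRestrict_apply _ _ htr]
              refine (hω t (ht.resolve_right fun h => htc (hsub h)) ?_).symm
              obtain rfl : t = r := htr
              exact notMem_after_of_subset_children subset_rfl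
            · rw [patch_of_notMem _ _ htr]
      · intro t ht _
        by_cases htr : t ∈ ({r} : Set T)
        · rw [patch_domRestrict_apply _ _ htr]
          refine hω t ht ?_
          obtain rfl : t = r := htr
          exact notMem_after_of_subset_children subset_rfl
        · rw [patch_of_notMem _ _ htr]

theorem joint_coherent (hQ : ∀ s, SepCoherent (Q s))
    (hpos : ∀ (s : T) (x : Assign X (mother s)), StrictlyPositive (upper (Q s x))) :
    IsCoherent (globalModels Q).joint :=
  (subtreeModel_coherent_and_pos hQ hpos ⊥ _).1.map _

theorem joint_neg (hQ : ∀ s, SepCoherent (Q s))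
    (hpos : ∀ (s : T) (x : Assign X (mother s)), StrictlyPositive (upper (Q s x)))
    {F : Gamble (∀ t, X t)} (hF : F ≤ 0) {ω : ∀ t, X t} (hω : F ω < 0) :
    (globalModels Q).joint F < 0 :=
  (subtreeModel_coherent_and_pos hQ hpos ⊥ _).1.neg_of_strictlyPositive
    (subtreeModel_coherent_and_pos hQ hpos ⊥ _).2 (fun _ => hF _)
    (y := fun t => ω t) hω

/-- Conditioning on non-parent non-descendants is irrelevant: the global models, also conditional
on such further variables, are the regular extensions of the joint. -/
theorem isRegular_branchModel (hQ : ∀ s, SepCoherent (Q s))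
    (hpos : ∀ (s : T) (x : Assign X (mother s)), StrictlyPositive (upper (Q s x)))
    {s : T} {S I : Set T} (hS : S ⊆ children s) (hs : {s} ⊆ I) (hI : Disjoint I (after S)) :
    IsRegular (globalModels Q).joint (branchModel (childrenModel Q s) hS hs) := by
  have hg := goodBlocks_subModels hQ hpos s
  have he := childrenModel_eq hQ hpos s
  rw [he]
  intro f z
  obtain ⟨z, rfl⟩ : ∃ z' : ∀ t, X t, I.domRestrict z' = z :=
    ⟨patch (Classical.arbitrary _) z, domRestrict_patch _ _⟩
  refine ⟨?_, fun ε hε => ?_⟩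
  · rw [joint_eq_lift _ z]
    refine lift_subtreeModel_nonneg hQ hpos (s := s) (fun ω => ?_) _ bot_le z
    rw [he]
    exact lift_childExt_gainAt_nonneg hg hS hs hI f _ ω
  · rw [joint_eq_lift _ z]
    refine lift_subtreeModel_neg hQ hpos
      ((isContingent_gainAt (branchModel (childExt (subModels Q s)) hS hs) f ε z).mono
        (after_mono hS)) (fun ω hω => ?_) ⊥ bot_le z fun _ _ _ => rfl
    rw [he]
    exact lift_childExt_gainAt_sub_neg hg hS hs hI f hε hω

theorem isRegular_model (hQ : ∀ s, SepCoherent (Q s))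
    (hpos : ∀ (s : T) (x : Assign X (mother s)), StrictlyPositive (upper (Q s x)))
    (j : Option (Branching T)) :
    SepCoherent ((globalModels Q).model j).low ∧
      IsRegular (globalModels Q).joint ((globalModels Q).model j) := by
  rcases j with _ | b
  · exact ⟨fun _ => (joint_coherent hQ hpos).map (fun (ω : ∀ t, X t) => Set.univ.domRestrict ω),
      isRegular_jointModel (joint_coherent hQ hpos)⟩
  · exact ⟨branchModel_coherent (childrenModel_coherent hQ hpos b.node) b.subset subset_rfl,
      isRegular_branchModel hQ hpos b.subset subset_rfl
        (Set.disjoint_singleton_left.2 (notMem_after_of_subset_children b.subset))⟩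

theorem isRegular_irrModel (hQ : ∀ s, SepCoherent (Q s))
    (hpos : ∀ (s : T) (x : Assign X (mother s)), StrictlyPositive (upper (Q s x)))
    (i : Irrelevance T) :
    SepCoherent ((globalModels Q).irrModel i).low ∧
      IsRegular (globalModels Q).joint ((globalModels Q).irrModel i) :=
  ⟨branchModel_coherent (childrenModel_coherent hQ hpos i.br.node) i.br.subset
      Set.subset_union_left,
    isRegular_branchModel hQ hpos i.br.subset Set.subset_union_left
      (Set.disjoint_union_left.2 ⟨Set.disjoint_singleton_left.2
        (notMem_after_of_subset_children i.br.subset),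
        disjoint_of_subset_nonParNonDesc i.subset⟩)⟩

theorem subtreeModel_extends (hQ : ∀ s, SepCoherent (Q s))
    (hpos : ∀ (s : T) (x : Assign X (mother s)), StrictlyPositive (upper (Q s x)))
    (s : T) (x : Assign X (mother s)) (f : Gamble (Assign X {s})) :
    subtreeModel Q s x (fun y => f (Set.domRestrict₂ (subset_after {s}) y)) = Q s x f := by
  rw [subtreeModel_apply (childrenModel_coherent hQ hpos s)]
  refine congrArg _ (funext fun a => ?_)
  have e : ∀ w : Assign X (after (children s)),
      Set.domRestrict₂ (subset_after {s}) (glue a w) = a := fun w => funext fun t => dif_pos t.2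
  simp only [e]
  exact (childrenModel_coherent hQ hpos s a).const _

theorem admissible_globalModels (hQ : ∀ s, SepCoherent (Q s))
    (hpos : ∀ (s : T) (x : Assign X (mother s)), StrictlyPositive (upper (Q s x))) :
    Admissible Q (globalModels Q) := by
  refine ⟨⟨fun x f => ?_, fun s c hc x f => ?_⟩, ?_, ?_⟩
  · have hx : x = fun t => (not_lt_bot t.2.lt).elim := funext fun t => (not_lt_bot t.2.lt).elim
    rw [← subtreeModel_extends hQ hpos ⊥ x f, hx]
    rfl
  · refine Eq.trans ?_ (subtreeModel_extends hQ hpos c _ f)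
    change childrenModel Q s x _ = _
    rw [childrenModel_eq hQ hpos]
    exact childExt_extends (goodBlocks_subModels hQ hpos s) hc x
      (fun y => f (Set.domRestrict₂ (subset_after {c}) y))
  · exact jointlyCoherent_of_isRegular (joint_coherent hQ hpos)
      (fun j => (isRegular_model hQ hpos j).1) fun j => (isRegular_model hQ hpos j).2
  · refine jointlyCoherent_of_isRegular (joint_coherent hQ hpos) ?_ ?_
    · rintro (j | i)
      exacts [(isRegular_model hQ hpos j).1, (isRegular_irrModel hQ hpos i).1]
    · rintro (j | i)
      exacts [(isRegular_model hQ hpos j).2, (isRegular_irrModel hQ hpos i).2]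

end Joint

/-! ### The smallest admissible family -/

section Smallest

variable {T : RootedTree.{u}} {X : T → Type v}

theorem lift_congr {O I : Set T} {V : CondLP X O I} (hOI : Disjoint O I) (F : Gamble (∀ t, X t))
    {ω ω' : ∀ t, X t} (h : ∀ t, t ∉ O → ω t = ω' t) : lift V F ω = lift V F ω' := by
  have h1 : I.domRestrict ω = I.domRestrict ω' :=
    funext fun t => h t (Set.disjoint_right.1 hOI t.2)
  have h2 : ∀ w : Assign X O, patch ω w = patch ω' w := fun w => by
    funext t
    by_cases ht : t ∈ O
    · rw [patch_of_mem _ _ ht, patch_of_mem _ _ ht]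
    · rw [patch_of_notMem _ _ ht, patch_of_notMem _ _ ht, h t ht]
  simp only [lift, h1, h2]

theorem disjoint_after_children (s : T) : Disjoint (after (children s)) {s} :=
  Set.disjoint_singleton_right.2 (notMem_after_of_subset_children subset_rfl)

variable [Finite T] [∀ t, Finite (X t)] [∀ t, Nonempty (X t)] {Q : LocalModels X}

/-- The conditional models of an admissible family dominate the natural extension of the models of
single children: the irrelevance requirement makes them accept the gains of the latter conditional
on the siblings' subtrees. -/
theorem childrenModel_le_cond (hQ : ∀ s, SepCoherent (Q s))
    (hpos : ∀ (s : T) (x : Assign X (mother s)), StrictlyPositive (upper (Q s x)))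
    {W : TreeFamily X} (hW : IrrelevanceCoherent W) (b : Branching T)
    (hsub : ∀ (c : T) (hc : c ∈ children b.node) (x : Assign X {b.node})
      (g : Gamble (Assign X (after {c}))), subModels Q b.node c hc x g ≤
        W.cond ⟨b.node, {c}, Set.singleton_nonempty c, Set.singleton_subset_iff.2 hc⟩ x g)
    (x : Assign X {b.node}) (g : Gamble (Assign X (after b.sub))) :
    childrenModel Q b.node x (fun y => g (Set.domRestrict₂ (after_mono b.subset) y)) ≤
      W.cond b x g := by
  have hb : IsCoherent (W.cond b x) := hW.1 (Sum.inl (some b)) x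
  obtain ⟨ω, rfl⟩ : ∃ ω : ∀ t, X t, Set.domRestrict {b.node} ω = x :=
    ⟨patch (Classical.arbitrary _) x, domRestrict_patch _ _⟩
  have hs := notMem_after_of_subset_children b.subset
  have key := (goodBlocks_subModels hQ hpos b.node (Set.domRestrict {b.node} ω)).natExt_le_of_accepts
    (A := after b.sub) (fun k => after_subset_or_disjoint k.2 b.subset) hb ω
    (f := fun ω => g ((after b.sub).domRestrict ω)) ?_
    (fun ω ω' h => congrArg g (funext fun t => h t t.2))
  · rw [childrenModel_eq hQ hpos]
    simp only [domRestrict_patch] at key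
    exact key
  · rintro ⟨k, hk⟩ hkS F
    let i : Irrelevance T := {
      br := ⟨b.node, {k}, Set.singleton_nonempty k, Set.singleton_subset_iff.2 hk⟩
      R := after b.sub \ after {k}
      subset := by
        intro t ht
        refine Set.mem_iInter₂.2 ?_
        rintro c (rfl : c = k) (h | h)
        · obtain rfl : t = b.node := mother_subset hk h
          exact hs ht.1
        · exact ht.2 h }
    have h := hW.lift_sub_nonneg (Sum.inl (some b)) (Sum.inr i) Set.subset_union_left ?_ F ω
    · refine h.trans (hb.mono fun (w : Assign X (after b.sub)) => ?_)
      refine sub_le_sub_left ?_ (F (patch ω w))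
      refine le_trans (le_of_eq ?_) (hsub k hk (Set.domRestrict {b.node} (patch ω w)) _)
      rw [domRestrict_patch_of_disjoint (Set.disjoint_singleton_right.2 hs) ω w]
      rfl
    · change after b.sub ∪ {b.node} = after {k} ∪ ({b.node} ∪ (after b.sub \ after {k}))
      rw [Set.union_left_comm, Set.union_sdiff_cancel hkS, Set.union_comm]

/-- A functional on the gambles on `X_{↓c}` that extends the local model of `c` and accepts the
gains of the model for `X_{↓C(c)}` dominates the global model for `X_{↓c}`. -/
theorem lift_subtreeModel_le (hQ : ∀ s, SepCoherent (Q s))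
    (hpos : ∀ (s : T) (x : Assign X (mother s)), StrictlyPositive (upper (Q s x)))
    {c : T} {O : Set T} (hO : O = after {c}) {V : Gamble (Assign X O) → ℝ} {ω : ∀ t, X t}
    {F : Gamble (∀ t, X t)}
    (hloc : ∀ f : Gamble (Assign X {c}), V (fun w => f (Set.domRestrict {c} (patch ω w))) =
      Q c ((mother c).domRestrict ω) f)
    (hacc : V (fun w => lift (childrenModel Q c) F (patch ω w)) ≤ V (fun w => F (patch ω w))) :
    lift (subtreeModel Q c) F ω ≤ V (fun w => F (patch ω w)) := by
  subst hO
  rw [lift_subtreeModel hQ hpos, ← hloc]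
  refine le_trans (le_of_eq (congrArg V (funext fun w => ?_))) hacc
  refine lift_congr (disjoint_after_children c) F fun t ht => ?_
  by_cases htc : t ∈ ({c} : Set T)
  · exact patch_domRestrict_apply _ _ htc
  · rw [patch_of_notMem _ _ htc, patch_of_notMem]
    rw [after_singleton_eq]
    exact fun h => h.elim htc ht

/-- The model for `X_{↓c}` in an admissible family does not increase when gambles are replaced by
their lower previsions given `X_c` under the global model for `X_{↓C(c)}`: it accepts the gains of
the family's own model for `X_{↓C(c)}`, as the mother variable of `c` is irrelevant to that model
given `X_c`. -/
theorem lift_childrenModel_le (hQ : ∀ s, SepCoherent (Q s))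
    (hpos : ∀ (s : T) (x : Assign X (mother s)), StrictlyPositive (upper (Q s x)))
    {W : TreeFamily X} (hW : IrrelevanceCoherent W) {c : T} (j : Option (Branching T))
    (hO : (W.model j).O = after {c}) (hI : (W.model j).I = mother c)
    (hsub : ∀ (d : T) (hd : d ∈ children c) (x : Assign X {c})
      (g : Gamble (Assign X (after {d}))), subModels Q c d hd x g ≤
        W.cond ⟨c, {d}, Set.singleton_nonempty d, Set.singleton_subset_iff.2 hd⟩ x g)
    (F : Gamble (∀ t, X t)) (ω : ∀ t, X t) :
    lift (W.model j).low (lift (childrenModel Q c) F) ω ≤ lift (W.model j).low F ω := by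
  have hj : IsCoherent ((W.model j).low ((W.model j).I.domRestrict ω)) := hW.1 (Sum.inl j) _
  by_cases hne : (children c).Nonempty
  · let b : Branching T := ⟨c, children c, hne, subset_rfl⟩
    let i : Irrelevance T := ⟨b, mother c, mother_subset_nonParNonDesc c⟩
    have h := hW.lift_sub_nonneg (Sum.inl j) (Sum.inr i) (hI.trans_subset Set.subset_union_right)
      ?_ F ω
    · refine le_trans (hj.mono fun w => ?_) (hj.le_of_nonneg_sub h)
      exact childrenModel_le_cond hQ hpos hW b hsub (Set.domRestrict {c} (patch ω w))
        (fun v => F (patch (patch ω w) v))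
    · change (W.model j).O ∪ (W.model j).I = after (children c) ∪ ({c} ∪ mother c)
      rw [hO, hI, after_singleton_eq, ← Set.union_assoc, Set.union_comm {c}]
  · refine le_of_eq (congrArg (fun G => lift (W.model j).low G ω) (funext fun ω' => ?_))
    have e : ∀ w : Assign X (after (children c)), patch ω' w = ω' := fun w => funext fun t =>
      patch_of_notMem _ _ fun ⟨d, hd, _⟩ => hne ⟨d, hd⟩
    simp only [lift, e]
    exact (childrenModel_coherent hQ hpos c _).const _

/-- Induction from the leaves: the global models of single children are dominated by the models of
an admissible family. -/
theorem subModels_le_cond (hQ : ∀ s, SepCoherent (Q s))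
    (hpos : ∀ (s : T) (x : Assign X (mother s)), StrictlyPositive (upper (Q s x)))
    {W : TreeFamily X} (hW : Admissible Q W) (c : T) :
    ∀ (s : T) (hc : c ∈ children s) (x : Assign X {s}) (g : Gamble (Assign X (after {c}))),
      subModels Q s c hc x g ≤
        W.cond ⟨s, {c}, Set.singleton_nonempty c, Set.singleton_subset_iff.2 hc⟩ x g := by
  induction c using WellFoundedGT.induction with
  | ind c ih =>
    intro s hc x g
    obtain ⟨ω, rfl⟩ : ∃ ω : ∀ t, X t, Set.domRestrict {s} ω = x :=
      ⟨patch (Classical.arbitrary _) x, domRestrict_patch _ _⟩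
    have hI : {s} = mother c :=
      (Set.singleton_subset_iff.2 hc : {s} ⊆ mother c).antisymm (mother_subset hc)
    have hacc := lift_childrenModel_le hQ hpos hW.2.2 (c := c)
      (some ⟨s, {c}, Set.singleton_nonempty c, Set.singleton_subset_iff.2 hc⟩) rfl hI
      (fun d hd x g => ih d hd.lt c hd x g) (fun ω => g ((after {c}).domRestrict ω)) ω
    have key := lift_subtreeModel_le hQ hpos (c := c) rfl ?_ hacc
    · simp only [lift, domRestrict_patch] at key
      exact key
    · intro f
      refine Eq.trans (congrArg (W.cond _ _) (funext fun (w : Assign X (after {c})) =>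
        congrArg f (funext fun t => ?_))) (hW.1.2 s c hc (Set.domRestrict {s} ω) f)
      exact patch_of_mem ω w (subset_after _ t.2)

/-- The family of global models is dominated by every admissible family. -/
theorem globalModels_le (hQ : ∀ s, SepCoherent (Q s))
    (hpos : ∀ (s : T) (x : Assign X (mother s)), StrictlyPositive (upper (Q s x)))
    {W : TreeFamily X} (hW : Admissible Q W) : globalModels Q ≤ W := by
  refine ⟨fun F => ?_, fun b x g => ?_⟩
  · let ω : ∀ t, X t := Classical.arbitrary _
    have hO : (W.model none).O = after {(⊥ : T)} :=
      (Set.eq_univ_of_forall fun t => mem_after_singleton.2 bot_le).symm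
    have hI : (W.model none).I = mother (⊥ : T) :=
      (Set.eq_empty_of_forall_notMem fun t ht => not_lt_bot ht.lt).symm
    have hacc := lift_childrenModel_le hQ hpos hW.2.2 none hO hI
      (fun d hd x g => subModels_le_cond hQ hpos hW d _ hd x g) F ω
    have hp : ∀ ω' : ∀ t, X t, patch ω (Set.univ.domRestrict ω') = ω' := fun ω' =>
      funext fun t => patch_domRestrict_apply _ _ (Set.mem_univ t)
    have key := lift_subtreeModel_le hQ hpos hO ?_ hacc
    · rw [← joint_eq_lift] at key
      exact key.trans_eq (congrArg W.joint (funext fun ω' => congrArg F (hp ω')))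
    · intro f
      refine Eq.trans (congrArg W.joint (funext fun ω' => ?_)) (hW.1.1 _ f)
      exact congrArg (fun ω => f (Set.domRestrict {(⊥ : T)} ω)) (hp ω')
  · exact childrenModel_le_cond hQ hpos hW.2.2 b
      (fun c hc x g => subModels_le_cond hQ hpos hW c _ hc x g) x g

end Smallest

/-! ### Regular extension -/

section RegularExtension

variable {T : RootedTree.{u}} {X : T → Type v}
  {P : Gamble (∀ t, X t) → ℝ} {E : Set T}

theorem le_of_mem_acceptablePrices [∀ t, Nonempty (X t)]
    (hneg : ∀ F : Gamble (∀ t, X t), F ≤ 0 → ∀ ω, F ω < 0 → P F < 0)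
    {x : Assign X E} {f : Gamble (∀ t, X t)} {μ c : ℝ} (hμ : μ ∈ acceptablePrices P x f)
    (hc : ∀ ω, f ω ≤ c) : μ ≤ c := by
  by_contra! hlt
  have h : ∀ ω, f ω - μ < 0 := fun ω => by linarith [hc ω]
  refine absurd hμ (not_le.2 (hneg _ (fun ω => ?_) (patch (Classical.arbitrary _) x) ?_))
  · exact Set.indicator_nonpos (fun ω _ => (h ω).le) ω
  · rw [Set.indicator_of_mem (s := cyl x) (domRestrict_patch _ _)]
    exact h _

theorem smul_mem_acceptablePrices (hP : IsCoherent P) {x : Assign X E} {f : Gamble (∀ t, X t)}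
    {μ c : ℝ} (hc : 0 ≤ c) (hμ : μ ∈ acceptablePrices P x f) :
    c * μ ∈ acceptablePrices P x (c • f) := by
  have h : (cyl x).indicator (fun ω => (c • f) ω - c * μ) =
      c • (cyl x).indicator (fun ω => f ω - μ) := by
    funext ω
    by_cases hω : ω ∈ cyl x <;> simp [hω, mul_sub]
  change 0 ≤ P _
  rw [h, hP.nonneg_hom _ _ hc]
  exact mul_nonneg hc hμ

variable [Finite T] [∀ t, Finite (X t)]

theorem iInf_mem_acceptablePrices (hP : IsCoherent P) (x : Assign X E) (f : Gamble (∀ t, X t)) :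
    ⨅ ω, f ω ∈ acceptablePrices P x f :=
  hP.nonneg (Set.indicator_nonneg fun ω _ =>
    sub_nonneg.2 (ciInf_le (Set.finite_range f).bddBelow ω))

variable [∀ t, Nonempty (X t)]

/-- The prices are bounded above because the upper probability of the conditioning event is
positive, and they form a closed set because a coherent lower prevision is continuous. -/
theorem isGreatest_regularExtension (hP : IsCoherent P)
    (hneg : ∀ F : Gamble (∀ t, X t), F ≤ 0 → ∀ ω, F ω < 0 → P F < 0)
    (x : Assign X E) (f : Gamble (∀ t, X t)) :
    IsGreatest (acceptablePrices P x f) (regularExtension P E x f) := by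
  obtain ⟨c, hc⟩ := (Set.finite_range f).bddAbove
  have hb : BddAbove (acceptablePrices P x f) :=
    ⟨c, fun μ hμ => le_of_mem_acceptablePrices hneg hμ fun ω => hc ⟨ω, rfl⟩⟩
  refine ⟨?_, fun μ hμ => le_csSup hb hμ⟩
  change 0 ≤ P ((cyl x).indicator fun ω => f ω - regularExtension P E x f)
  refine le_of_forall_pos_le_add fun ε hε => ?_
  obtain ⟨μ, hμ, hlt⟩ := exists_lt_of_lt_csSup ⟨_, iInf_mem_acceptablePrices hP x f⟩
    (sub_lt_self (regularExtension P E x f) hε)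
  have h1 := hP.sub_const ((cyl x).indicator fun ω => f ω - μ) ε
  have h2 : 0 ≤ P ((cyl x).indicator fun ω => f ω - μ) := hμ
  have h3 : (fun ω => (cyl x).indicator (fun ω => f ω - μ) ω - ε) ≤
      (cyl x).indicator fun ω => f ω - regularExtension P E x f := by
    intro ω
    beta_reduce
    by_cases hω : ω ∈ cyl x
    · rw [Set.indicator_of_mem hω, Set.indicator_of_mem hω]
      linarith
    · rw [Set.indicator_of_notMem hω, Set.indicator_of_notMem hω]
      linarith
  have h4 := hP.mono h3
  linarith

theorem regularExtension_coherent (hP : IsCoherent P)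
    (hneg : ∀ F : Gamble (∀ t, X t), F ≤ 0 → ∀ ω, F ω < 0 → P F < 0) (x : Assign X E) :
    IsCoherent (regularExtension P E x) := by
  have hR := isGreatest_regularExtension hP hneg x
  refine ⟨fun f => (hR f).2 (iInf_mem_acceptablePrices hP x f), fun f g => (hR _).2 ?_,
    fun c f hc => ?_⟩
  · have h := hP.superadd ((cyl x).indicator fun ω => f ω - regularExtension P E x f)
      ((cyl x).indicator fun ω => g ω - regularExtension P E x g)
    refine ((add_nonneg (hR f).1 (hR g).1).trans h).trans_eq (congrArg P (funext fun ω => ?_))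
    by_cases hω : ω ∈ cyl x
    · simp only [Pi.add_apply, Set.indicator_of_mem hω]
      ring
    · simp only [Pi.add_apply, Set.indicator_of_notMem hω, add_zero]
  · apply le_antisymm
    · rcases hc.eq_or_lt with rfl | hc
      · rw [zero_mul]
        exact le_of_mem_acceptablePrices hneg (hR _).1 fun ω => by simp
      · have h := (hR f).2 (by
          simpa [smul_smul, inv_mul_cancel₀ hc.ne'] using
            smul_mem_acceptablePrices hP (inv_nonneg.2 hc.le) (hR (c • f)).1)
        rwa [inv_mul_le_iff₀ hc] at h
    · exact (hR _).2 (smul_mem_acceptablePrices hP hc (hR f).1)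

theorem regularModel_coherent (hP : IsCoherent P)
    (hneg : ∀ F : Gamble (∀ t, X t), F ≤ 0 → ∀ ω, F ω < 0 → P F < 0) :
    SepCoherent (regularModel P E).low :=
  fun x => (regularExtension_coherent hP hneg x).map fun ω : ∀ t, X t => Eᶜ.domRestrict ω

theorem isRegular_regularModel (hP : IsCoherent P)
    (hneg : ∀ F : Gamble (∀ t, X t), F ≤ 0 → ∀ ω, F ω < 0 → P F < 0) :
    IsRegular P (regularModel P E) := by
  intro f z
  have hR := isGreatest_regularExtension hP hneg z (fun ω => f z (Eᶜ.domRestrict ω))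
  change IsGreatest _ (regularExtension P E z (fun ω => f z (Eᶜ.domRestrict ω))) at hR
  set μ := regularExtension P E z (fun ω => f z (Eᶜ.domRestrict ω))
  have e : (regularModel P E).gainAt f z =
      (cyl z).indicator fun ω => f z (Eᶜ.domRestrict ω) - μ := by
    refine Set.indicator_congr fun ω hω => ?_
    obtain rfl : E.domRestrict ω = z := hω
    rfl
  refine ⟨e ▸ hR.1, fun ε hε => ?_⟩
  have e' : (regularModel P E).gainAt f z - (cyl z).indicator (fun _ => ε) =
      (cyl z).indicator fun ω => f z (Eᶜ.domRestrict ω) - (μ + ε) := by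
    rw [e]
    funext ω
    rw [Pi.sub_apply]
    by_cases hω : ω ∈ cyl z
    · rw [Set.indicator_of_mem hω, Set.indicator_of_mem hω, Set.indicator_of_mem hω]
      ring
    · rw [Set.indicator_of_notMem hω, Set.indicator_of_notMem hω, Set.indicator_of_notMem hω,
        sub_zero]
  rw [e']
  by_contra! h
  have := hR.2 h
  linarith

end RegularExtension

end CredalTree

open CredalTree

theorem mainTheorem1 (T : RootedTree) [Finite T] (X : T → Type*)
    [∀ t, Finite (X t)] [∀ t, Nonempty (X t)]
    (Q : LocalModels X) (hQ : ∀ s, SepCoherent (Q s))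
    (hpos : ∀ (s : T) (x : Assign X (mother s)), StrictlyPositive (upper (Q s x))) :
    -- the recursion is well defined: the conditionally independent natural extensions exist
    (∀ s : T, (children s).Nonempty →
      IsLeast {R | IsCondIndProduct s
        (fun _ hc z => subtreeModel Q _ (Set.domRestrict₂ (mother_subset hc) z)) R}
        (childrenModel Q s)) ∧
    -- the global models form the point-wise smallest family that satisfies T1, T2 and T3
    IsLeast {V : TreeFamily X | ExtendsLocal Q V ∧ FamilyCoherent V ∧ IrrelevanceCoherent V} (globalModels Q) ∧
    -- they form the unique family that satisfies T1, T2, T3 and T4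
    (∀ V : TreeFamily X,
      (ExtendsLocal Q V ∧ FamilyCoherent V ∧ IrrelevanceCoherent V ∧ MostConservative Q V) ↔
        V = globalModels Q) ∧
    -- updating the joint by regular extension is jointly coherent with the family
    (∀ E : Set T, E.Nonempty →
      (∀ (x : Assign X E) (f : Gamble (∀ t, X t)),
        IsGreatest (acceptablePrices (globalModels Q).joint x f)
          (regularExtension (globalModels Q).joint E x f)) ∧
      JointlyCoherent (Sum.elim (globalModels Q).model
        (fun _ : Unit => regularModel (globalModels Q).joint E))) := by
  have hJ := joint_coherent hQ hpos
  have hneg : ∀ F : Gamble (∀ t, X t), F ≤ 0 → ∀ ω, F ω < 0 → (globalModels Q).joint F < 0 :=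
    fun F hF ω hω => joint_neg hQ hpos hF hω
  have hleast : IsLeast {V : TreeFamily X |
      ExtendsLocal Q V ∧ FamilyCoherent V ∧ IrrelevanceCoherent V} (globalModels Q) :=
    ⟨admissible_globalModels hQ hpos, fun W hW => globalModels_le hQ hpos hW⟩
  refine ⟨fun s _ => ?_, hleast, fun V => ⟨?_, ?_⟩, fun E _ => ⟨fun x f => ?_, ?_⟩⟩
  · rw [childrenModel_eq hQ hpos]
    exact isLeast_childExt (goodBlocks_subModels hQ hpos s)
  · rintro ⟨h1, h2, h3, h4⟩
    have hle := h4 _ hleast.1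
    have hge := hleast.2 (show V ∈ _ from ⟨h1, h2, h3⟩)
    exact TreeFamily.ext (le_antisymm hle.1 hge.1) (le_antisymm hle.2 hge.2)
  · rintro rfl
    exact ⟨hleast.1.1, hleast.1.2.1, hleast.1.2.2, fun W hW => hleast.2 hW⟩
  · exact isGreatest_regularExtension hJ hneg x f
  · refine jointlyCoherent_of_isRegular hJ ?_ ?_
    · rintro (j | _)
      exacts [(isRegular_model hQ hpos j).1, regularModel_coherent hJ hneg]
    · rintro (j | _)
      exacts [(isRegular_model hQ hpos j).2, isRegular_regularModel hJ hneg]
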